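/- Let $0<a<\tfrac16$ and let $F:\mathbb R^2\to\mathbb R^2$ be $$F(x,y)=\bigl(x+2a\sin x+a\sin y,\; y+a\sin x+2a\sin y\bigr).$$ Put $S_{10}=\{-x\le y\le -x+2\pi,\ x-2\pi\le y\le x\}$, $s_1=\{x-\pi\le y\le x,\ -x\le y\le -x+\pi\}$ and $s_4=\{x-2\pi\le y\le x-\pi,\ -x+\pi\le y\le -x+2\pi\}$. A heteroclinic curve from a fixed point $p$ to a fixed point $q\ne p$ is a set $\gamma$ with $F(\gamma)=\gamma$ that is the image of an injective smooth ($C^\infty$) immersion $c:\mathbb R\to\mathbb R^2$ with $c(t)\to p$ as $t\to-\infty$ and $c(t)\to q$ as $t\to+\infty$, and each point $z$ of which has a full orbit $(X_n)_{n\in\mathbb Z}$, $X_0=z$, $X_{n+1}=F(X_n)$, with $X_n\to p$ as $n\to-\infty$ and $X_n\to q$ as $n\to+\infty$. For a neighbourhood $U$ of $(\pi,0)$ let $W^s_{\rm loc}$ be the set of points whose forward orbit stays in $U$ and converges to $(\pi,0)$, and let $W^s(\pi,0)=\bigcup_{n\ge0}F^{-n}(W^s_{\rm loc})$. The fixed points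 $(0,0)$ and $(2\pi,0)$ are unstable nodes (two real eigenvalues of modulus $>1$), $(\pi,0)$ is a saddle (one eigenvalue of modulus $<1$ and one of modulus $>1$), and $F(S_{10})=S_{10}$. There are sets $\gamma^L$ and $\gamma^R$ such that: 1. $\gamma^L\subset\operatorname{int}(s_1)$ is a heteroclinic curve from $(0,0)$ to $(\pi,0)$. 2. $\gamma^R=\{(2\pi-x,-y):(x,y)\in\gamma^L\}$, the image of $\gamma^L$ under the rotation by $\pi$ about $(\pi,0)$, is a heteroclinic curve from $(2\pi,0)$ to $(\pi,0)$, and $\gamma^R\subset\operatorname{int}(s_4)$. 3. For every $U$, $W^s(\pi,0)\cap\operatorname{int}(s_1)=\gamma^L$, $W^s(\pi,0)\cap s_1=\gamma^L\cup\{(\pi,0)\}$ and $W^s(\pi,0)=\gamma^L\cup\gamma^R\cup\{(\pi,0)\}$. Moreover there is an injective smooth immersion $c:\mathbb R\to\mathbb R^2$ with $c(0)=(\pi,0)$, $c'(0)=(2+\sqrt3,1)$, $c((-\infty,0))=\gamma^L$ and $c((0,\infty))=\gamma^R$. 4. Let $\eta=\gamma^L\cup\gamma^R\cup\{(\pi,0)\}$.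 Then $\overline\eta=\eta\cup\{(0,0),(2\pi,0)\}$, and $\operatorname{int}(S_{10})\setminus\eta$ is the disjoint union of two connected open sets, the points of $\operatorname{int}(S_{10})$ vertically above and those vertically below $\eta$, each of which is mapped by $F$ onto itself. Likewise $S_{10}\setminus\overline\eta$ is the disjoint union of the points of $S_{10}$ above $\eta$ and those below $\eta$, and $F$ maps each of these two sets onto itself. -/

import Mathlib

open Set Filter Topology
open scoped ContDiff

namespace AlignedClocks

noncomputable section

/-- The phase-difference map of three aligned clocks with coupling `a`. -/
def F (a : ℝ) (z : ℝ × ℝ) : ℝ × ℝ :=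
  (z.1 + 2 * a * Real.sin z.1 + a * Real.sin z.2,
   z.2 + a * Real.sin z.1 + 2 * a * Real.sin z.2)

/-- The invariant square with vertices `(0,0)`, `(π,π)`, `(2π,0)`, `(π,-π)`. -/
def S10 : Set (ℝ × ℝ) :=
  {z | (-z.1 ≤ z.2 ∧ z.2 ≤ -z.1 + 2 * Real.pi) ∧ (z.1 - 2 * Real.pi ≤ z.2 ∧ z.2 ≤ z.1)}

/-- The left one of the four small squares that make up `S10`. -/
def s1 : Set (ℝ × ℝ) :=
  {z | (z.1 - Real.pi ≤ z.2 ∧ z.2 ≤ z.1) ∧ (-z.1 ≤ z.2 ∧ z.2 ≤ -z.1 + Real.pi)}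

/-- The right one of the four small squares that make up `S10`. -/
def s4 : Set (ℝ × ℝ) :=
  {z | (z.1 - 2 * Real.pi ≤ z.2 ∧ z.2 ≤ z.1 - Real.pi) ∧
    (-z.1 + Real.pi ≤ z.2 ∧ z.2 ≤ -z.1 + 2 * Real.pi)}

/-- The internal symmetry of `S10`: the rotation by `π` about `(π,0)`. -/
def rot (z : ℝ × ℝ) : ℝ × ℝ := (2 * Real.pi - z.1, -z.2)

/-- A fixed point at which the derivative has two real eigenvalues, both outside the unit circle. -/
def IsUnstableNode (f : ℝ × ℝ → ℝ × ℝ) (p : ℝ × ℝ) : Prop :=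
  f p = p ∧ DifferentiableAt ℝ f p ∧ ∃ l m : ℝ, 1 < |l| ∧ 1 < |m| ∧
    (fderiv ℝ f p : (ℝ × ℝ) →ₗ[ℝ] (ℝ × ℝ)).charpoly =
      (Polynomial.X - Polynomial.C l) * (Polynomial.X - Polynomial.C m)

/-- A fixed point at which the derivative has one eigenvalue inside and one outside
the unit circle. -/
def IsSaddle (f : ℝ × ℝ → ℝ × ℝ) (p : ℝ × ℝ) : Prop :=
  f p = p ∧ DifferentiableAt ℝ f p ∧ ∃ l m : ℝ, |l| < 1 ∧ 1 < |m| ∧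
    (fderiv ℝ f p : (ℝ × ℝ) →ₗ[ℝ] (ℝ × ℝ)).charpoly =
      (Polynomial.X - Polynomial.C l) * (Polynomial.X - Polynomial.C m)

/-- The local stable manifold of `p` in the neighbourhood `U`: the points whose forward orbit
stays in `U` and converges to `p`. -/
def localStableManifold (f : ℝ × ℝ → ℝ × ℝ) (p : ℝ × ℝ) (U : Set (ℝ × ℝ)) : Set (ℝ × ℝ) :=
  {z | (∀ n : ℕ, f^[n] z ∈ U) ∧ Tendsto (fun n : ℕ => f^[n] z) atTop (𝓝 p)}

/-- The global stable manifold of `p`: the union of the preimages under the iterates of `f` of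
the local stable manifold in `U`. -/
def stableManifold (f : ℝ × ℝ → ℝ × ℝ) (p : ℝ × ℝ) (U : Set (ℝ × ℝ)) : Set (ℝ × ℝ) :=
  ⋃ n : ℕ, f^[n] ⁻¹' localStableManifold f p U

/-- An injectively immersed smooth curve. -/
def IsSmoothCurve (c : ℝ → ℝ × ℝ) : Prop :=
  ContDiff ℝ ∞ c ∧ Function.Injective c ∧ ∀ t, deriv c t ≠ 0

/-- `γ` is a heteroclinic curve of `f` from `p` to `q`: a strongly invariant smooth curve without
self-intersections that runs from `p` to `q`, each of whose points has a full orbit that tends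
to `p` in the past and to `q` in the future. -/
structure IsHeteroclinicCurve (f : ℝ × ℝ → ℝ × ℝ) (p q : ℝ × ℝ) (γ : Set (ℝ × ℝ)) : Prop where
  ne : p ≠ q
  fixed_left : f p = p
  fixed_right : f q = q
  curve : ∃ c : ℝ → ℝ × ℝ, IsSmoothCurve c ∧ range c = γ ∧
    Tendsto c atBot (𝓝 p) ∧ Tendsto c atTop (𝓝 q)
  invariant : f '' γ = γ
  orbit : ∀ z ∈ γ, ∃ X : ℤ → ℝ × ℝ, X 0 = z ∧ (∀ n, X (n + 1) = f (X n)) ∧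
    Tendsto X atBot (𝓝 p) ∧ Tendsto X atTop (𝓝 q)

/-- The points of `A` that lie vertically above a point of `η`. -/
def above (η A : Set (ℝ × ℝ)) : Set (ℝ × ℝ) := {z ∈ A | ∃ w ∈ η, w.1 = z.1 ∧ w.2 < z.2}

/-- The points of `A` that lie vertically below a point of `η`. -/
def below (η A : Set (ℝ × ℝ)) : Set (ℝ × ℝ) := {z ∈ A | ∃ w ∈ η, w.1 = z.1 ∧ z.2 < w.2}

/-- The curve `η` splits the interior of `A` into two disjoint domains, the part above and the
part below `η`, each strongly invariant under `f`; and the closure of `η` splits `A` itself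
into two disjoint strongly invariant sets. -/
structure SplitsInvariantly (f : ℝ × ℝ → ℝ × ℝ) (η A : Set (ℝ × ℝ)) : Prop where
  isOpen_above : IsOpen (above η (interior A))
  isOpen_below : IsOpen (below η (interior A))
  isConnected_above : IsConnected (above η (interior A))
  isConnected_below : IsConnected (below η (interior A))
  disjoint_interior : Disjoint (above η (interior A)) (below η (interior A))
  union_interior : above η (interior A) ∪ below η (interior A) = interior A \ η
  invariant_above : f '' above η (interior A) = above η (interior A)
  invariant_below : f '' below η (interior A) = below η (interior A)
  disjoint_self : Disjoint (above η A) (below η A)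
  union_self : above η A ∪ below η A = A \ closure η
  invariant_above_self : f '' above η A = above η A
  invariant_below_self : f '' below η A = below η A

end

end AlignedClocks

/-!
The complexification of `F a` is holomorphic, and because its inverse derivative at the saddle is
dominated by the square of the stable eigenvalue `λ = 1 - √3 a`, the equation `F (c t) = c (λ t)`
is solved near `t = 0` by a uniform limit of holomorphic iterates. Its real trace, continued to all
`t` by means of `F⁻¹`, is a smooth curve `c` through the saddle that lies in the basin of the saddle
and inherits the symmetry `c (-t) = rot (c t)`.

That there is nothing else in the basin follows from an order argument. On `S10` the map `F a` is
monotone for the order with positive cone `|Δx| ≤ Δy`, and near the saddle it does not decrease the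
vertical distance of two comparable points. Two comparable points of the basin would therefore have
orbits that do not approach each other, so the basin is an antichain, that is, part of the graph of
a 1-Lipschitz function of `x`. The curve `c` converges in backward parameter time to a fixed point,
which can only be the node `(0, 0)`, and by symmetry to `(2π, 0)` in the other direction; hence it
passes over every `x ∈ (0, 2π)` and is the whole basin. Monotonicity also shows that a point above
the curve is mapped to a point above it, and the rotation by `π` turns this into the statement for
the points below.
-/

namespace AlignedClocks

noncomputable section

open Real

/-! ### Analytic curves that linearize a map along an eigenvector -/

section Linearization

variable {E : Type*} [NormedAddCommGroup E] [NormedSpace ℂ E]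

theorem exists_norm_sub_le_of_fderiv_eq_zero {g : E → E} (hg : ContDiff ℂ 2 g)
    (hg0 : fderiv ℂ g 0 = 0) :
    ∃ K ≥ (0 : ℝ), ∃ r > 0, ∀ z w, ‖z‖ ≤ r → ‖w‖ ≤ r →
      ‖g z - g w‖ ≤ K * max ‖z‖ ‖w‖ * ‖z - w‖ := by
  obtain ⟨K, s, hs, hK⟩ := (hg.fderiv_right (m := 1) (by norm_num)).contDiffAt
    (x := (0 : E)).exists_lipschitzOnWith
  obtain ⟨r, hr, hrs⟩ := Metric.nhds_basis_closedBall.mem_iff.1 hs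
  refine ⟨K, K.2, r, hr, fun z w hz hw => ?_⟩
  have hd : Differentiable ℂ g := hg.differentiable (by norm_num)
  refine (convex_closedBall (0 : E) (max ‖z‖ ‖w‖)).norm_image_sub_le_of_norm_fderiv_le
    (fun x _ => hd x) (fun x hx => ?_) (by simp) (by simp)
  have hx : ‖x‖ ≤ max ‖z‖ ‖w‖ := by simpa using hx
  have hxs : x ∈ s := hrs (by simpa using hx.trans (max_le hz hw))
  have h := hK.norm_sub_le hxs (hrs (Metric.mem_closedBall_self hr.le))
  rw [hg0, sub_zero, sub_zero] at h
  exact h.trans (by gcongr)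

/-- The iterates that approximate the solution of `Φ t = L (Φ (l * t) - g (Φ t))` tangent to `v`
at `0`. For `L` the inverse of the linear part and `g` the higher order part of a map `f`, the
equation says `f (Φ t) = Φ (l * t)`. -/
def linearizingSeq (L : E →L[ℂ] E) (g : E → E) (l : ℂ) (v : E) : ℕ → ℂ → E
  | 0, t => t • v
  | n + 1, t => L (linearizingSeq L g l v n (l * t) - g (linearizingSeq L g l v n t))

variable {L : E →L[ℂ] E} {g : E → E} {l : ℂ} {v : E}

theorem differentiable_linearizingSeq (hg : Differentiable ℂ g) (n : ℕ) :
    Differentiable ℂ (linearizingSeq L g l v n) := by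
  induction n with
  | zero => exact differentiable_id.smul_const v
  | succ n ih =>
    exact L.differentiable.comp ((ih.comp (differentiable_id.const_mul l)).sub (hg.comp ih))

theorem linearizingSeq_equivariant (σ : E →+ E) {τ : ℂ → ℂ} (hL : ∀ w, L (σ w) = σ (L w))
    (hg : ∀ w, g (σ w) = σ (g w)) (hl : ∀ t, l * τ t = τ (l * t))
    (hv : ∀ t : ℂ, τ t • v = σ (t • v)) (n : ℕ) (t : ℂ) :
    linearizingSeq L g l v n (τ t) = σ (linearizingSeq L g l v n t) := by
  induction n generalizing t with
  | zero => exact hv t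
  | succ n ih => rw [linearizingSeq, linearizingSeq, ← hL, map_sub σ, ← hg, ← ih, ← ih, hl]

theorem norm_le_of_norm_sub_smul_le {B : ℝ} {w : E} {t : ℂ} (hBt : B * ‖t‖ ≤ 1)
    (h : ‖w - t • v‖ ≤ B * ‖t‖ ^ 2) : ‖w‖ ≤ (‖v‖ + 1) * ‖t‖ := by
  have h1 : ‖w‖ ≤ ‖w - t • v‖ + ‖t • v‖ := by
    simpa using norm_add_le (w - t • v) (t • v)
  rw [norm_smul] at h1
  nlinarith [norm_nonneg t]

variable {K r B ρ : ℝ}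

theorem norm_linearizingSeq_sub_smul_le
    (hg : ∀ z w, ‖z‖ ≤ r → ‖w‖ ≤ r → ‖g z - g w‖ ≤ K * max ‖z‖ ‖w‖ * ‖z - w‖) (hg0 : g 0 = 0)
    (hK : 0 ≤ K) (hl : ‖l‖ ≤ 1) (hLv : L (l • v) = v) (hB : 0 ≤ B)
    (hLB : ‖L‖ * ‖l‖ ^ 2 * B + ‖L‖ * K * (‖v‖ + 1) ^ 2 ≤ B) (hr : (‖v‖ + 1) * ρ ≤ r)
    (hBρ : B * ρ ≤ 1) (n : ℕ) {t : ℂ} (ht : ‖t‖ ≤ ρ) :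
    ‖linearizingSeq L g l v n t - t • v‖ ≤ B * ‖t‖ ^ 2 := by
  induction n generalizing t with
  | zero => simpa [linearizingSeq] using by positivity
  | succ n ih =>
    set M := ‖v‖ + 1
    have hlt : ‖l * t‖ = ‖l‖ * ‖t‖ := norm_mul l t
    have h1 := ih (t := l * t) (by rw [hlt]; nlinarith [norm_nonneg t])
    have h2 : ‖linearizingSeq L g l v n t‖ ≤ M * ‖t‖ :=
      norm_le_of_norm_sub_smul_le ((mul_le_mul_of_nonneg_left ht hB).trans hBρ) (ih ht)
    have hr' : M * ‖t‖ ≤ r := le_trans (by gcongr) hr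
    have h3 : ‖g (linearizingSeq L g l v n t)‖ ≤ K * (M * ‖t‖) * (M * ‖t‖) := by
      have h := hg _ 0 (h2.trans hr') (by simpa using le_trans (by positivity) hr')
      rw [hg0, sub_zero, sub_zero, norm_zero, max_eq_left (norm_nonneg _)] at h
      exact h.trans (by gcongr)
    have h4 : linearizingSeq L g l v (n + 1) t - t • v =
        L (linearizingSeq L g l v n (l * t) - (l * t) • v - g (linearizingSeq L g l v n t)) := by
      have : L ((l * t) • v) = t • v := by rw [mul_comm, mul_smul, map_smul, hLv]
      simp only [linearizingSeq, map_sub, this]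
      abel
    calc ‖linearizingSeq L g l v (n + 1) t - t • v‖
        ≤ ‖L‖ * (B * ‖l * t‖ ^ 2 + K * (M * ‖t‖) * (M * ‖t‖)) := by
          rw [h4]
          exact L.le_of_opNorm_le_of_le le_rfl ((norm_sub_le _ _).trans (add_le_add h1 h3))
      _ = (‖L‖ * ‖l‖ ^ 2 * B + ‖L‖ * K * M ^ 2) * ‖t‖ ^ 2 := by rw [hlt]; ring
      _ ≤ B * ‖t‖ ^ 2 := by gcongr

theorem norm_linearizingSeq_succ_sub_le
    (hg : ∀ z w, ‖z‖ ≤ r → ‖w‖ ≤ r → ‖g z - g w‖ ≤ K * max ‖z‖ ‖w‖ * ‖z - w‖) (hg0 : g 0 = 0)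
    (hK : 0 ≤ K) (hl : ‖l‖ ≤ 1) (hLv : L (l • v) = v) (hB : 0 ≤ B)
    (hLB : ‖L‖ * ‖l‖ ^ 2 * B + ‖L‖ * K * (‖v‖ + 1) ^ 2 ≤ B) (hr : (‖v‖ + 1) * ρ ≤ r)
    (hBρ : B * ρ ≤ 1) {θ : ℝ} (hθ0 : 0 ≤ θ)
    (hθ : ‖L‖ * ‖l‖ ^ 2 + ‖L‖ * K * (‖v‖ + 1) * ρ ≤ θ) (n : ℕ) {t : ℂ} (ht : ‖t‖ ≤ ρ) :
    ‖linearizingSeq L g l v (n + 1) t - linearizingSeq L g l v n t‖ ≤ B * ‖t‖ ^ 2 * θ ^ n := by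
  have hbound : ∀ n, ∀ t : ℂ, ‖t‖ ≤ ρ → ‖linearizingSeq L g l v n t - t • v‖ ≤ B * ‖t‖ ^ 2 :=
    fun n t => norm_linearizingSeq_sub_smul_le hg hg0 hK hl hLv hB hLB hr hBρ n
  induction n generalizing t with
  | zero => simpa [linearizingSeq] using hbound 1 t ht
  | succ n ih =>
    set M := ‖v‖ + 1
    set D : ℕ → ℂ → E :=
      fun n t => linearizingSeq L g l v (n + 1) t - linearizingSeq L g l v n t with hD
    have hlt : ‖l * t‖ = ‖l‖ * ‖t‖ := norm_mul l t
    have h1 : ‖D n (l * t)‖ ≤ B * ‖l * t‖ ^ 2 * θ ^ n :=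
      ih (by rw [hlt]; nlinarith [norm_nonneg t])
    have h2 : ∀ n, ‖linearizingSeq L g l v n t‖ ≤ M * ‖t‖ := fun n =>
      norm_le_of_norm_sub_smul_le ((mul_le_mul_of_nonneg_left ht hB).trans hBρ) (hbound n t ht)
    have h3 : ‖g (linearizingSeq L g l v (n + 1) t) - g (linearizingSeq L g l v n t)‖ ≤
        K * (M * ρ) * (B * ‖t‖ ^ 2 * θ ^ n) := by
      have hM : M * ‖t‖ ≤ M * ρ := by gcongr
      refine (hg _ _ ((h2 _).trans (hM.trans hr)) ((h2 _).trans (hM.trans hr))).trans ?_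
      exact mul_le_mul (mul_le_mul_of_nonneg_left
        (max_le ((h2 _).trans hM) ((h2 _).trans hM)) hK) (ih ht) (norm_nonneg _)
        (mul_nonneg hK ((norm_nonneg _).trans ((h2 0).trans hM)))
    have h4 : D (n + 1) t = L (D n (l * t) -
        (g (linearizingSeq L g l v (n + 1) t) - g (linearizingSeq L g l v n t))) := by
      simp only [hD, linearizingSeq, map_sub]
      abel
    calc ‖D (n + 1) t‖
        ≤ ‖L‖ * (B * ‖l * t‖ ^ 2 * θ ^ n + K * (M * ρ) * (B * ‖t‖ ^ 2 * θ ^ n)) := by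
          rw [h4]
          exact L.le_of_opNorm_le_of_le le_rfl ((norm_sub_le _ _).trans (add_le_add h1 h3))
      _ = (‖L‖ * ‖l‖ ^ 2 + ‖L‖ * K * M * ρ) * (B * ‖t‖ ^ 2 * θ ^ n) := by rw [hlt]; ring
      _ ≤ θ * (B * ‖t‖ ^ 2 * θ ^ n) := by gcongr
      _ = B * ‖t‖ ^ 2 * θ ^ (n + 1) := by ring

theorem exists_linearizingSeq_bounds (hg : ContDiff ℂ 2 g) (hg0 : g 0 = 0)
    (hg1 : fderiv ℂ g 0 = 0) (hl : ‖l‖ ≤ 1) (hLl : ‖L‖ * ‖l‖ ^ 2 < 1) (hLv : L (l • v) = v) :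
    ∃ ρ > 0, ∃ B, ∃ θ ∈ Ico (0 : ℝ) 1, ∀ n, ∀ t : ℂ, ‖t‖ ≤ ρ →
      ‖linearizingSeq L g l v n t - t • v‖ ≤ B * ‖t‖ ^ 2 ∧
      ‖linearizingSeq L g l v (n + 1) t - linearizingSeq L g l v n t‖ ≤
        B * ‖t‖ ^ 2 * θ ^ n := by
  obtain ⟨K, hK, r, hr, hKr⟩ := exists_norm_sub_le_of_fderiv_eq_zero hg hg1
  set q := ‖L‖ * ‖l‖ ^ 2
  have : 0 ≤ q := by positivity
  set B := ‖L‖ * K * (‖v‖ + 1) ^ 2 / (1 - q)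
  have hB : 0 ≤ B := div_nonneg (by positivity) (by linarith)
  have hqB : q * B + ‖L‖ * K * (‖v‖ + 1) ^ 2 ≤ B := by
    have : B * (1 - q) = ‖L‖ * K * (‖v‖ + 1) ^ 2 := div_mul_cancel₀ _ (by linarith)
    linarith
  obtain ⟨ρ, hρ, hρr, hBρ, hθ⟩ : ∃ ρ > 0, (‖v‖ + 1) * ρ < r ∧ B * ρ < 1 ∧
      q + ‖L‖ * K * (‖v‖ + 1) * ρ < (1 + q) / 2 := by
    have hlim : ∀ p b c : ℝ, p < c → ∀ᶠ ρ in 𝓝[>] (0 : ℝ), p + b * ρ < c := fun p b c h => by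
      have : Continuous fun ρ : ℝ => p + b * ρ := by fun_prop
      exact nhdsWithin_le_nhds ((this.tendsto 0).eventually_lt_const (by simpa using h))
    obtain ⟨ρ, h1, h2, h3, h4⟩ := ((hlim 0 (‖v‖ + 1) r hr).and ((hlim 0 B 1 one_pos).and
      ((hlim q (‖L‖ * K * (‖v‖ + 1)) ((1 + q) / 2) (by linarith)).and
        self_mem_nhdsWithin))).exists
    exact ⟨ρ, h4, by simpa using h1, by simpa using h2, h3⟩
  have hθ0 : 0 ≤ (1 + q) / 2 := by positivity
  exact ⟨ρ, hρ, B, (1 + q) / 2, ⟨hθ0, by linarith⟩, fun n t ht =>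
    ⟨norm_linearizingSeq_sub_smul_le hKr hg0 hK hl hLv hB hqB hρr.le hBρ.le n ht,
      norm_linearizingSeq_succ_sub_le hKr hg0 hK hl hLv hB hqB hρr.le hBρ.le hθ0 hθ.le n ht⟩⟩

theorem tendstoUniformlyOn_of_dist_le_geometric {α β : Type*} [PseudoMetricSpace β]
    {f : ℕ → α → β} {φ : α → β} {s : Set α} {C θ : ℝ} (hθ0 : 0 ≤ θ) (hθ1 : θ < 1)
    (hf : ∀ x ∈ s, ∀ n, dist (f n x) (f (n + 1) x) ≤ C * θ ^ n)
    (hφ : ∀ x ∈ s, Tendsto (fun n => f n x) atTop (𝓝 (φ x))) :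
    TendstoUniformlyOn f φ atTop s := by
  rw [Metric.tendstoUniformlyOn_iff]
  intro ε hε
  have h0 : Tendsto (fun n : ℕ => C * θ ^ n / (1 - θ)) atTop (𝓝 0) := by
    simpa using ((tendsto_pow_atTop_nhds_zero_of_lt_one hθ0 hθ1).const_mul C).div_const (1 - θ)
  filter_upwards [h0.eventually_lt_const hε] with n hn x hx
  rw [dist_comm]
  exact (dist_le_of_le_geometric_of_tendsto θ C hθ1 (hf x hx) (hφ x hx) n).trans_lt hn

theorem hasDerivAt_zero_of_norm_sub_smul_le {Φ : ℂ → E} {B ρ : ℝ} (hρ : 0 < ρ)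
    (hΦ : ∀ t ∈ Metric.ball (0 : ℂ) ρ, ‖Φ t - t • v‖ ≤ B * ‖t‖ ^ 2) : HasDerivAt Φ v 0 := by
  have hΦ0 : Φ 0 = 0 := by simpa using hΦ 0 (Metric.mem_ball_self hρ)
  have hO : (fun t => Φ t - t • v) =O[𝓝 0] fun t : ℂ => t ^ 2 :=
    Asymptotics.IsBigO.of_bound B <| by
      filter_upwards [Metric.ball_mem_nhds 0 hρ] with t ht
      simpa using hΦ t ht
  rw [hasDerivAt_iff_isLittleO_nhds_zero]
  simpa [hΦ0] using hO.trans_isLittleO (Asymptotics.isLittleO_pow_id one_lt_two)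

theorem exists_tendsto_linearizingSeq [CompleteSpace E] (hg : ContDiff ℂ 2 g) (hg0 : g 0 = 0)
    (hg1 : fderiv ℂ g 0 = 0) (hl : ‖l‖ ≤ 1) (hLl : ‖L‖ * ‖l‖ ^ 2 < 1) (hLv : L (l • v) = v) :
    ∃ ρ > 0, ∃ Φ : ℂ → E, DifferentiableOn ℂ Φ (Metric.ball 0 ρ) ∧ HasDerivAt Φ v 0 ∧
      ∀ t ∈ Metric.ball (0 : ℂ) ρ,
        Tendsto (fun n => linearizingSeq L g l v n t) atTop (𝓝 (Φ t)) ∧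
        Φ t = L (Φ (l * t) - g (Φ t)) := by
  obtain ⟨ρ, hρ, B, θ, ⟨hθ0, hθ1⟩, hbound⟩ := exists_linearizingSeq_bounds hg hg0 hg1 hl hLl hLv
  set Φ : ℂ → E := fun t => limUnder atTop fun n => linearizingSeq L g l v n t
  have hball : ∀ t ∈ Metric.ball (0 : ℂ) ρ, ‖t‖ ≤ ρ := fun t ht => (mem_ball_zero_iff.1 ht).le
  have hgeom : ∀ t ∈ Metric.ball (0 : ℂ) ρ, ∀ n, dist (linearizingSeq L g l v n t)
      (linearizingSeq L g l v (n + 1) t) ≤ B * ‖t‖ ^ 2 * θ ^ n := fun t ht n => by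
    rw [dist_comm, dist_eq_norm]
    exact (hbound n t (hball t ht)).2
  have hlim : ∀ t ∈ Metric.ball (0 : ℂ) ρ,
      Tendsto (fun n => linearizingSeq L g l v n t) atTop (𝓝 (Φ t)) := fun t ht =>
    (cauchySeq_of_le_geometric θ _ hθ1 (hgeom t ht)).tendsto_limUnder
  have hdiff : DifferentiableOn ℂ Φ (Metric.ball 0 ρ) := by
    have hunif : TendstoUniformlyOn (linearizingSeq L g l v) Φ atTop (Metric.ball 0 ρ) := by
      refine tendstoUniformlyOn_of_dist_le_geometric (C := |B| * ρ ^ 2) hθ0 hθ1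
        (fun t ht n => (hgeom t ht n).trans ?_) hlim
      have := hball t ht
      gcongr
      exact le_abs_self B
    exact hunif.tendstoLocallyUniformlyOn.differentiableOn (Eventually.of_forall fun n =>
      (differentiable_linearizingSeq (hg.differentiable (by norm_num)) n).differentiableOn)
      Metric.isOpen_ball
  have hderiv : HasDerivAt Φ v 0 := hasDerivAt_zero_of_norm_sub_smul_le hρ fun t ht =>
    le_of_tendsto ((hlim t ht).sub_const _).norm
      (Eventually.of_forall fun n => (hbound n t (hball t ht)).1)
  refine ⟨ρ, hρ, Φ, hdiff, hderiv, fun t ht => ⟨hlim t ht, ?_⟩⟩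
  have hlt : l * t ∈ Metric.ball (0 : ℂ) ρ := by
    rw [mem_ball_zero_iff] at ht ⊢
    rw [norm_mul]
    nlinarith [norm_nonneg t]
  exact tendsto_nhds_unique ((tendsto_add_atTop_iff_nat 1).2 (hlim t ht))
    ((L.continuous.tendsto _).comp
      ((hlim _ hlt).sub ((hg.continuous.tendsto _).comp (hlim t ht))))

theorem exists_linearizing_curve [CompleteSpace E] {f : E → E} {A : E ≃L[ℂ] E}
    (hf : ContDiff ℂ 2 f) (hf0 : f 0 = 0) (hA : HasFDerivAt f (A : E →L[ℂ] E) 0) (hl : ‖l‖ ≤ 1)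
    (hAl : ‖(A.symm : E →L[ℂ] E)‖ * ‖l‖ ^ 2 < 1) (hAv : A v = l • v) :
    ∃ ρ > 0, ∃ Φ : ℂ → E, DifferentiableOn ℂ Φ (Metric.ball 0 ρ) ∧ HasDerivAt Φ v 0 ∧
      (∀ t ∈ Metric.ball (0 : ℂ) ρ, f (Φ t) = Φ (l * t)) ∧
      ∀ (σ : E →+ E) (τ : ℂ → ℂ), Continuous σ → (∀ w, f (σ w) = σ (f w)) →
        (∀ w, A (σ w) = σ (A w)) → (∀ t, l * τ t = τ (l * t)) → (∀ t : ℂ, τ t • v = σ (t • v)) →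
        ∀ t ∈ Metric.ball (0 : ℂ) ρ, τ t ∈ Metric.ball (0 : ℂ) ρ → Φ (τ t) = σ (Φ t) := by
  have hg : ContDiff ℂ 2 fun w => f w - A w := hf.sub A.contDiff
  have hg1 : fderiv ℂ (fun w => f w - A w) 0 = 0 :=
    (hA.sub A.hasFDerivAt).fderiv.trans (sub_self _)
  obtain ⟨ρ, hρ, Φ, hdiff, hderiv, hΦ⟩ := exists_tendsto_linearizingSeq hg (by simp [hf0]) hg1 hl
    hAl (show (A.symm : E →L[ℂ] E) (l • v) = v by simp [← hAv])
  refine ⟨ρ, hρ, Φ, hdiff, hderiv, fun t ht => ?_, fun σ τ hσ hfσ hAσ hτl hτv t ht hτt => ?_⟩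
  · have h := congrArg A (hΦ t ht).2
    rw [ContinuousLinearEquiv.coe_coe, A.apply_symm_apply] at h
    exact (sub_left_injective (h.symm.trans (sub_sub_cancel _ _).symm)).symm
  · have hAσ' : ∀ w, (A.symm : E →L[ℂ] E) (σ w) = σ (A.symm w) := fun w => by
      simp [ContinuousLinearEquiv.symm_apply_eq, hAσ]
    refine tendsto_nhds_unique (hΦ _ hτt).1 (((hσ.tendsto _).comp (hΦ t ht).1).congr fun n => ?_)
    exact (linearizingSeq_equivariant σ hAσ' (fun w => by simp [hfσ, hAσ]) hτl hτv n t).symm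

end Linearization

/-! ### Curves on which a map acts by contracting the parameter -/

section Semiconj

theorem mul_mem_Ioo_neg {l ρ t : ℝ} (hl0 : 0 ≤ l) (hl1 : l ≤ 1) (ht : t ∈ Ioo (-ρ) ρ) :
    l * t ∈ Ioo (-ρ) ρ := by
  rw [mem_Ioo, ← abs_lt] at ht ⊢
  rw [abs_mul, abs_of_nonneg hl0]
  exact (mul_le_of_le_one_left (abs_nonneg t) hl1).trans_lt ht

theorem tendsto_pow_mul_nhds_zero {l : ℝ} (hl0 : 0 ≤ l) (hl1 : l < 1) (t : ℝ) :
    Tendsto (fun n : ℕ => l ^ n * t) atTop (𝓝 0) := by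
  simpa using (tendsto_pow_atTop_nhds_zero_of_lt_one hl0 hl1).mul_const t

variable {X : Type*} {l ρ : ℝ}

theorem iterate_of_semiconj_mul {f : X → X} {c : ℝ → X} (h : Function.Semiconj c (l * ·) f) (n : ℕ)
    (t : ℝ) : f^[n] (c t) = c (l ^ n * t) := by
  simpa [mul_left_iterate] using ((h.iterate_right n) t).symm

theorem exists_semiconj_eqOn (e : X ≃ X) (hl0 : 0 ≤ l) (hl1 : l < 1) (hρ : 0 < ρ) {φ : ℝ → X}
    (hφ : ∀ t ∈ Ioo (-ρ) ρ, φ (l * t) = e (φ t)) :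
    ∃ c : ℝ → X, EqOn c φ (Ioo (-ρ) ρ) ∧ Function.Semiconj c (l * ·) e := by
  have hiter (t) (ht : t ∈ Ioo (-ρ) ρ) (k : ℕ) : e.symm^[k] (φ (l ^ k * t)) = φ t := by
    induction k with
    | zero => simp
    | succ k ih =>
      have hk : l ^ k * t ∈ Ioo (-ρ) ρ :=
        mul_mem_Ioo_neg (pow_nonneg hl0 k) (pow_le_one₀ hl0 hl1.le) ht
      rw [Function.iterate_succ_apply, pow_succ', mul_assoc, hφ _ hk, e.symm_apply_apply, ih]
  choose n hn using fun t : ℝ => ((tendsto_pow_mul_nhds_zero hl0 hl1 t).eventually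
    (Ioo_mem_nhds (neg_lt_zero.2 hρ) hρ)).exists
  have hadd (t) (m k : ℕ) (hm : l ^ m * t ∈ Ioo (-ρ) ρ) :
      e.symm^[m + k] (φ (l ^ (m + k) * t)) = e.symm^[m] (φ (l ^ m * t)) := by
    rw [Function.iterate_add_apply, add_comm, pow_add, mul_assoc, hiter _ hm]
  have hn_eq (t) (m : ℕ) (hm : l ^ m * t ∈ Ioo (-ρ) ρ) :
      e.symm^[n t] (φ (l ^ n t * t)) = e.symm^[m] (φ (l ^ m * t)) := by
    rw [← hadd t m (n t) hm, ← hadd t (n t) m (hn t), add_comm]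
  refine ⟨fun t => e.symm^[n t] (φ (l ^ n t * t)), fun t ht => ?_, fun t => ?_⟩
  · simpa using hn_eq t 0 (by simpa using ht)
  · have h1 : l ^ n t * (l * t) ∈ Ioo (-ρ) ρ := by
      simpa [mul_left_comm] using mul_mem_Ioo_neg hl0 hl1.le (hn t)
    have h2 : l ^ (n t + 1) * t ∈ Ioo (-ρ) ρ := by rwa [pow_succ, mul_assoc]
    change e.symm^[n (l * t)] (φ (l ^ n (l * t) * (l * t))) = e (e.symm^[n t] (φ (l ^ n t * t)))
    rw [hn_eq _ (n t) h1, hn_eq t (n t + 1) h2, Function.iterate_succ_apply', e.apply_symm_apply,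
      pow_succ, mul_assoc]

theorem injective_of_semiconj_mul {f : X → X} {c : ℝ → X} (h : Function.Semiconj c (l * ·) f)
    (hl0 : 0 < l) (hl1 : l < 1) {s : Set ℝ} (hs : s ∈ 𝓝 0) (hc : InjOn c s) :
    Function.Injective c := by
  intro t t' htt
  obtain ⟨n, hn, hn'⟩ := (((tendsto_pow_mul_nhds_zero hl0.le hl1 t).eventually hs).and
    ((tendsto_pow_mul_nhds_zero hl0.le hl1 t').eventually hs)).exists
  have := hc hn hn' (by rw [← iterate_of_semiconj_mul h, ← iterate_of_semiconj_mul h, htt])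
  exact mul_left_cancel₀ (pow_pos hl0 n).ne' this

variable {V : Type*} [NormedAddCommGroup V] [NormedSpace ℝ V] {f : V → V} {c : ℝ → V}

theorem contDiff_of_semiconj_mul {g : V → V} {N : ℕ∞ω} (h : Function.Semiconj c (l * ·) f)
    (hg : ContDiff ℝ N g) (hgf : Function.LeftInverse g f) (hl0 : 0 ≤ l) (hl1 : l < 1)
    (hc : ∀ᶠ t in 𝓝 0, ContDiffAt ℝ N c t) : ContDiff ℝ N c := by
  rw [contDiff_iff_contDiffAt]
  intro t
  obtain ⟨n, hn⟩ := ((tendsto_pow_mul_nhds_zero hl0 hl1 t).eventually hc).exists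
  have hcn : c = fun s => g^[n] (c (l ^ n * s)) := funext fun s => by
    rw [← iterate_of_semiconj_mul h, hgf.iterate n]
  have hgn : ContDiff ℝ N g^[n] := by
    clear hn hcn
    induction n with
    | zero => exact contDiff_id
    | succ n ih => exact ih.comp hg
  rw [hcn]
  exact hgn.contDiffAt.comp t
    (hn.comp t (contDiff_const.mul contDiff_id).contDiffAt)

theorem deriv_ne_zero_of_semiconj_mul (h : Function.Semiconj c (l * ·) f) (hl0 : 0 < l)
    (hl1 : l < 1) (hf : Differentiable ℝ f) (hc : ContDiff ℝ 1 c) (hc0 : deriv c 0 ≠ 0) (t : ℝ) :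
    deriv c t ≠ 0 := by
  have hd (s) : HasDerivAt c (deriv c s) s := (hc.differentiable one_ne_zero s).hasDerivAt
  have hstep (s) (hs : deriv c s = 0) : deriv c (l * s) = 0 := by
    have h1 := (hf (c s)).hasFDerivAt.comp_hasDerivAt s (hd s)
    have h2 := HasDerivAt.scomp s (hd (l * s)) ((hasDerivAt_id s).const_mul l)
    rw [← h.comp_eq] at h1
    have h3 := h2.unique h1
    rw [hs, map_zero, mul_one] at h3
    exact (smul_eq_zero.1 h3).resolve_left hl0.ne'
  intro ht
  have hzero (n : ℕ) : deriv c (l ^ n * t) = 0 := by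
    induction n with
    | zero => simpa using ht
    | succ n ih => rw [pow_succ', mul_assoc]; exact hstep _ ih
  have hne := ((hc.continuous_deriv le_rfl).tendsto 0).eventually_ne hc0
  obtain ⟨n, hn⟩ := ((tendsto_pow_mul_nhds_zero hl0.le hl1 t).eventually hne).exists
  exact hn (hzero n)

theorem exists_injOn_of_hasStrictDerivAt {v : V} {x : ℝ} (hc : HasStrictDerivAt c v x)
    (hv : v ≠ 0) : ∃ s ∈ 𝓝 x, InjOn c s := by
  obtain ⟨g, -, hg⟩ := exists_dual_vector ℝ v (norm_ne_zero_iff.2 hv)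
  have h := (g.hasStrictFDerivAt.comp_hasStrictDerivAt x hc).hasStrictFDerivAt_equiv
    (by simpa [hg] using hv)
  exact ⟨_, (h.toOpenPartialHomeomorph _).open_source.mem_nhds
    h.mem_toOpenPartialHomeomorph_source,
    fun s hs t ht hst => (h.toOpenPartialHomeomorph _).injOn hs ht (congrArg g hst)⟩

end Semiconj

theorem isSmoothCurve_of_semiconj_mul {f : ℝ × ℝ → ℝ × ℝ} {c : ℝ → ℝ × ℝ} {l : ℝ}
    (h : Function.Semiconj c (l * ·) f) (hl0 : 0 < l) (hl1 : l < 1) (hf : Differentiable ℝ f)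
    (hc : ContDiff ℝ ∞ c) (hc0 : deriv c 0 ≠ 0) : IsSmoothCurve c := by
  obtain ⟨s, hs, hinj⟩ :=
    exists_injOn_of_hasStrictDerivAt (hc.contDiffAt.hasStrictDerivAt (by simp)) hc0
  exact ⟨hc, injective_of_semiconj_mul h hl0 hl1 hs hinj,
    deriv_ne_zero_of_semiconj_mul h hl0 hl1 hf (hc.of_le (by simp)) hc0⟩

theorem isSmoothCurve_comp_neg_exp_neg {c : ℝ → ℝ × ℝ} (hc : IsSmoothCurve c) :
    IsSmoothCurve fun t => c (-exp (-t)) := by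
  refine ⟨hc.1.comp (contDiff_exp.comp contDiff_neg).neg, fun s t h => by simpa using hc.2.1 h,
    fun t => ?_⟩
  have h1 : HasDerivAt (fun t : ℝ => -exp (-t)) (exp (-t)) t :=
    ((hasDerivAt_neg t).exp.fun_neg).congr_deriv (by ring)
  have h2 := HasDerivAt.scomp t (hc.1.differentiable (by simp) (-exp (-t))).hasDerivAt h1
  have h3 : deriv (fun t => c (-exp (-t))) t = exp (-t) • deriv c (-exp (-t)) := h2.deriv
  rw [h3]
  exact smul_ne_zero (exp_pos _).ne' (hc.2.2 _)

theorem range_comp_neg_exp_neg {X : Type*} (c : ℝ → X) :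
    range (fun t => c (-exp (-t))) = c '' Iio 0 := by
  ext z
  constructor
  · rintro ⟨t, rfl⟩
    exact ⟨_, neg_lt_zero.2 (exp_pos _), rfl⟩
  · rintro ⟨t, ht, rfl⟩
    exact ⟨-log (-t), by beta_reduce; rw [neg_neg, exp_log (neg_pos.2 ht), neg_neg]⟩

section Orbit

variable {l : ℝ}

theorem tendsto_zpow_atBot_atTop_of_lt_one (hl0 : 0 < l) (hl1 : l < 1) :
    Tendsto (fun n : ℤ => l ^ n) atBot atTop := by
  simpa [Function.comp_def] using (tendsto_rpow_atBot_of_base_lt_one l hl0 hl1).comp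
    (tendsto_intCast_atBot_iff.2 (tendsto_id (α := ℤ)))

theorem tendsto_zpow_atTop_nhds_zero_of_lt_one (hl0 : 0 < l) (hl1 : l < 1) :
    Tendsto (fun n : ℤ => l ^ n) atTop (𝓝 0) := by
  simpa [Function.comp_def] using (tendsto_rpow_atTop_of_base_lt_one l (by linarith) hl1).comp
    (tendsto_intCast_atTop_atTop (R := ℝ))

theorem exists_orbit_of_semiconj_mul {X : Type*} [TopologicalSpace X] {f : X → X} {c : ℝ → X}
    {p : X} (h : Function.Semiconj c (l * ·) f) (hl0 : 0 < l) (hl1 : l < 1) (hc : ContinuousAt c 0)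
    (hp : Tendsto c atBot (𝓝 p)) {t : ℝ} (ht : t < 0) :
    ∃ Y : ℤ → X, Y 0 = c t ∧ (∀ n, Y (n + 1) = f (Y n)) ∧ Tendsto Y atBot (𝓝 p) ∧
      Tendsto Y atTop (𝓝 (c 0)) := by
  refine ⟨fun n => c (l ^ n * t), by simp, fun n => ?_, ?_, ?_⟩
  · change c (l ^ (n + 1) * t) = f (c (l ^ n * t))
    rw [← h, zpow_add_one₀ hl0.ne', mul_comm (l ^ n), mul_assoc]
  · exact hp.comp ((tendsto_zpow_atBot_atTop_of_lt_one hl0 hl1).atTop_mul_const_of_neg ht)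
  · refine hc.tendsto.comp ?_
    simpa using (tendsto_zpow_atTop_nhds_zero_of_lt_one hl0 hl1).mul_const t

theorem image_image_Iio_of_semiconj_mul {X : Type*} {f : X → X} {c : ℝ → X}
    (h : Function.Semiconj c (l * ·) f) (hl0 : 0 < l) : f '' (c '' Iio 0) = c '' Iio 0 := by
  rw [← h.set_image (Iio 0)]
  simp [image_mul_left_Iio hl0]

end Orbit

theorem isHeteroclinicCurve_image_Iio {f : ℝ × ℝ → ℝ × ℝ} {c : ℝ → ℝ × ℝ} {l : ℝ} {p : ℝ × ℝ}
    (h : Function.Semiconj c (l * ·) f) (hl0 : 0 < l) (hl1 : l < 1) (hc : IsSmoothCurve c)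
    (hp : Tendsto c atBot (𝓝 p)) (hfp : f p = p) (hpc : p ≠ c 0) :
    IsHeteroclinicCurve f p (c 0) (c '' Iio 0) where
  ne := hpc
  fixed_left := hfp
  fixed_right := by simpa using (h 0).symm
  curve := by
    refine ⟨_, isSmoothCurve_comp_neg_exp_neg hc, range_comp_neg_exp_neg c,
      hp.comp (tendsto_neg_atTop_atBot.comp (tendsto_exp_atTop.comp tendsto_neg_atBot_atTop)),
      (hc.1.continuous.tendsto 0).comp ?_⟩
    simpa using (tendsto_exp_atBot.comp tendsto_neg_atTop_atBot).neg
  invariant := image_image_Iio_of_semiconj_mul h hl0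
  orbit := by
    rintro _ ⟨t, ht, rfl⟩
    exact exists_orbit_of_semiconj_mul h hl0 hl1 hc.1.continuous.continuousAt hp ht

theorem isClosed_insert_image_Ici {X : Type*} [TopologicalSpace X] [T2Space X] {c : ℝ → X} {q : X}
    (hc : Continuous c) (hq : Tendsto c atTop (𝓝 q)) : IsClosed (insert q (c '' Ici 0)) := by
  have habs : Tendsto (fun t : ℝ => |t|) (cocompact ℝ) atTop := tendsto_norm_cocompact_atTop
  have hrange : range (c ∘ fun t => |t|) = c '' Ici 0 := by
    ext z
    constructor
    · rintro ⟨t, rfl⟩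
      exact ⟨|t|, abs_nonneg t, rfl⟩
    · rintro ⟨t, ht, rfl⟩
      exact ⟨t, congrArg c (abs_of_nonneg ht)⟩
  rw [← hrange]
  exact ((hq.comp habs).isCompact_insert_range_of_cocompact (hc.comp continuous_abs)).isClosed

theorem closure_range_of_tendsto {X : Type*} [TopologicalSpace X] [T2Space X] {c : ℝ → X} {p q : X}
    (hc : Continuous c) (hp : Tendsto c atBot (𝓝 p)) (hq : Tendsto c atTop (𝓝 q)) :
    closure (range c) = range c ∪ {p, q} := by
  refine Subset.antisymm (closure_minimal subset_union_left ?_) (union_subset subset_closure ?_)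
  · have hrange : range c ∪ {p, q} =
        insert q (c '' Ici 0) ∪ insert p ((fun t => c (-t)) '' Ici 0) := by
      rw [← image_univ, ← Ici_union_Iic (a := (0 : ℝ)), image_union,
        show (fun t => c (-t)) = c ∘ Neg.neg from rfl, image_comp, image_neg_Ici, neg_zero]
      grind
    rw [hrange]
    exact (isClosed_insert_image_Ici hc hq).union
      (isClosed_insert_image_Ici (hc.comp continuous_neg) (hp.comp tendsto_neg_atTop_atBot))
  · rintro z (rfl | rfl)
    · exact mem_closure_of_tendsto hp (Eventually.of_forall mem_range_self)
    · exact mem_closure_of_tendsto hq (Eventually.of_forall mem_range_self)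

/-! ### Basins of attraction and invariant sets -/

section Basin

variable {X : Type*} [TopologicalSpace X] {f : X → X} {p : X}

/-- The basin of attraction of `p`: the points whose forward orbit converges to `p`. -/
def basin (f : X → X) (p : X) : Set X := {z | Tendsto (fun n : ℕ => f^[n] z) atTop (𝓝 p)}

theorem tendsto_iterate_of_mem_basin {z : X} (hz : z ∈ basin f p) :
    Tendsto (fun n : ℕ => f^[n] z) atTop (𝓝 p) := hz

theorem iterate_mem_basin_iff (n : ℕ) {z : X} : f^[n] z ∈ basin f p ↔ z ∈ basin f p := by
  have hshift : (fun k => f^[k] (f^[n] z)) = fun k => f^[k + n] z :=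
    funext fun k => (Function.iterate_add_apply f k n z).symm
  change Tendsto (fun k => f^[k] (f^[n] z)) atTop (𝓝 p) ↔ _
  rw [hshift]
  exact tendsto_add_atTop_iff_nat (f := fun k => f^[k] z) n

theorem preimage_basin : f ⁻¹' basin f p = basin f p := ext fun _ => iterate_mem_basin_iff 1

theorem basin_subset_of_preimage_eq {S : Set X} (hfS : f ⁻¹' S = S) (hS : S ∈ 𝓝 p) :
    basin f p ⊆ S := fun z hz => by
  obtain ⟨n, hn⟩ := ((tendsto_iterate_of_mem_basin hz).eventually hS).exists
  have hS : f^[n] ⁻¹' S = S := Function.IsFixedPt.preimage_iterate hfS n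
  exact hS ▸ hn

end Basin

theorem stableManifold_eq_basin {f : ℝ × ℝ → ℝ × ℝ} {p : ℝ × ℝ} {U : Set (ℝ × ℝ)} (hU : U ∈ 𝓝 p) :
    stableManifold f p U = basin f p := by
  ext z
  simp only [stableManifold, mem_iUnion, mem_preimage]
  refine ⟨fun ⟨n, hn⟩ => (iterate_mem_basin_iff n).1 hn.2, fun hz => ?_⟩
  obtain ⟨n, hn⟩ := eventually_atTop.1 ((tendsto_iterate_of_mem_basin hz).eventually hU)
  refine ⟨n, fun k => ?_, (iterate_mem_basin_iff n).2 hz⟩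
  rw [← Function.iterate_add_apply]
  exact hn _ (by lia)

theorem image_eq_of_preimage_eq {α : Type*} {f : α → α} (hf : Function.Surjective f) {s : Set α}
    (h : f ⁻¹' s = s) : f '' s = s := by
  conv_lhs => rw [← h]
  exact image_preimage_eq s hf

theorem image_eq_of_mapsTo_of_disjoint {α : Type*} {f : α → α} {P Q R : Set α} (hPQ : P ∪ Q = R)
    (hd : Disjoint P Q) (hR : f '' R = R) (hP : MapsTo f P P) (hQ : MapsTo f Q Q) :
    f '' P = P := by
  refine Subset.antisymm hP.image_subset fun z hz => ?_
  obtain ⟨y, hy, rfl⟩ : z ∈ f '' R := by rw [hR, ← hPQ]; exact Or.inl hz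
  rw [← hPQ] at hy
  rcases hy with hy | hy
  · exact ⟨y, hy, rfl⟩
  · exact (disjoint_left.1 hd hz (hQ hy)).elim

/-! ### The clock map as a diffeomorphism of the plane -/

/-- The derivative of `F a` at `z`. -/
def dF (a : ℝ) (z : ℝ × ℝ) : (ℝ × ℝ) →L[ℝ] (ℝ × ℝ) :=
  ((1 + 2 * a * cos z.1) • ContinuousLinearMap.fst ℝ ℝ ℝ +
    (a * cos z.2) • ContinuousLinearMap.snd ℝ ℝ ℝ).prod
  ((a * cos z.1) • ContinuousLinearMap.fst ℝ ℝ ℝ +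
    (1 + 2 * a * cos z.2) • ContinuousLinearMap.snd ℝ ℝ ℝ)

theorem dF_apply (a : ℝ) (z d : ℝ × ℝ) : dF a z d =
    ((1 + 2 * a * cos z.1) * d.1 + a * cos z.2 * d.2,
      a * cos z.1 * d.1 + (1 + 2 * a * cos z.2) * d.2) := by
  simp [dF]

theorem hasFDerivAt_F (a : ℝ) (z : ℝ × ℝ) : HasFDerivAt (F a) (dF a z) z := by
  have h₁ : HasFDerivAt Prod.fst (ContinuousLinearMap.fst ℝ ℝ ℝ) z := hasFDerivAt_fst
  have h₂ : HasFDerivAt Prod.snd (ContinuousLinearMap.snd ℝ ℝ ℝ) z := hasFDerivAt_snd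
  have h := ((h₁.add (h₁.sin.const_mul (2 * a))).add (h₂.sin.const_mul a)).prodMk
    ((h₂.add (h₁.sin.const_mul a)).add (h₂.sin.const_mul (2 * a)))
  refine h.congr_fderiv ?_
  ext <;> simp [dF]

theorem contDiff_F (a : ℝ) : ContDiff ℝ ∞ (F a) := by
  unfold F
  fun_prop

theorem continuous_F (a : ℝ) : Continuous (F a) := (contDiff_F a).continuous

theorem approximatesLinearOn_F (a : ℝ) :
    ApproximatesLinearOn (F a) (ContinuousLinearEquiv.refl ℝ (ℝ × ℝ) : (ℝ × ℝ) →L[ℝ] (ℝ × ℝ))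
      univ (3 * ‖a‖₊) := by
  intro z _ w _
  have hsin : ∀ x y : ℝ, |x - y| ≤ ‖z - w‖ → |sin x - sin y| ≤ ‖z - w‖ := fun x y hxy => by
    have hlip := Real.lipschitzWith_sin.dist_le_mul x y
    rw [Real.dist_eq, Real.dist_eq, NNReal.coe_one, one_mul] at hlip
    exact hlip.trans hxy
  have h₁ := hsin z.1 w.1 (norm_fst_le (z - w))
  have h₂ := hsin z.2 w.2 (norm_snd_le (z - w))
  have hcomb : ∀ s t : ℝ, |s| ≤ ‖z - w‖ → |t| ≤ ‖z - w‖ →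
      |a * (2 * s + t)| ≤ 3 * |a| * ‖z - w‖ := fun s t hs ht => by
    have : |2 * s + t| ≤ 3 * ‖z - w‖ := by
      rw [abs_le] at *
      constructor <;> linarith
    rw [abs_mul]
    linarith [mul_le_mul_of_nonneg_left this (abs_nonneg a)]
  have hF : F a z - F a w - (z - w) = (a * (2 * (sin z.1 - sin w.1) + (sin z.2 - sin w.2)),
      a * (2 * (sin z.2 - sin w.2) + (sin z.1 - sin w.1))) := by
    ext <;> simp only [F, Prod.fst_sub, Prod.snd_sub] <;> ring
  change ‖F a z - F a w - (z - w)‖ ≤ 3 * |a| * ‖z - w‖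
  rw [hF]
  exact norm_prod_le_iff.2 ⟨hcomb _ _ h₁ h₂, hcomb _ _ h₂ h₁⟩

/-- `F a` as a homeomorphism of the plane. -/
def homeoF {a : ℝ} (ha : |a| < 1 / 3) : (ℝ × ℝ) ≃ₜ (ℝ × ℝ) :=
  (approximatesLinearOn_F a).toHomeomorph (F a) <| Or.inr <| by
    have hid : ‖((ContinuousLinearEquiv.refl ℝ (ℝ × ℝ)).symm : (ℝ × ℝ) →L[ℝ] (ℝ × ℝ))‖₊ = 1 :=
      ContinuousLinearMap.nnnorm_id
    rw [hid, inv_one, ← NNReal.coe_lt_coe]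
    push_cast
    rw [Real.norm_eq_abs]
    linarith

theorem F_surjective {a : ℝ} (ha : |a| < 1 / 3) : Function.Surjective (F a) :=
  (homeoF ha).surjective

theorem dF_injective {a : ℝ} (ha : |a| < 1 / 3) (z : ℝ × ℝ) : Function.Injective (dF a z) := by
  refine (injective_iff_map_eq_zero _).2 fun d hd => ?_
  rw [dF_apply] at hd
  obtain ⟨e₁, e₂⟩ := Prod.mk.inj hd
  have hcos : ∀ x, -(1 / 3) < a * cos x := fun x => (abs_lt.1 <| by
    rw [abs_mul]
    exact (mul_le_of_le_one_right (abs_nonneg a) (abs_cos_le_one x)).trans_lt ha).1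
  set p := a * cos z.1 with hp
  set q := a * cos z.2 with hq
  have hdet : 0 < (1 + 2 * p) * (1 + 2 * q) - p * q := by
    have hp' : 0 < p + 1 / 3 := by linarith [hcos z.1]
    have hq' : 0 < q + 1 / 3 := by linarith [hcos z.2]
    nlinarith [mul_pos hp' hq']
  have f₁ : (1 + 2 * p) * d.1 + q * d.2 = 0 := by rw [hp]; linarith
  have f₂ : p * d.1 + (1 + 2 * q) * d.2 = 0 := by rw [hq]; linarith
  have g₁ : ((1 + 2 * p) * (1 + 2 * q) - p * q) * d.1 = 0 := by
    linear_combination (1 + 2 * q) * f₁ - q * f₂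
  have g₂ : ((1 + 2 * p) * (1 + 2 * q) - p * q) * d.2 = 0 := by
    linear_combination (1 + 2 * p) * f₂ - p * f₁
  exact Prod.ext ((mul_eq_zero.1 g₁).resolve_left hdet.ne')
    ((mul_eq_zero.1 g₂).resolve_left hdet.ne')

theorem contDiff_homeoF_symm {a : ℝ} (ha : |a| < 1 / 3) : ContDiff ℝ ∞ (homeoF ha).symm := by
  refine (homeoF ha).contDiff_symm (f₀' := fun z =>
    (LinearEquiv.ofInjectiveEndo (dF a z : (ℝ × ℝ) →ₗ[ℝ] (ℝ × ℝ))
      (dF_injective ha z)).toContinuousLinearEquiv) (fun z => ?_) (contDiff_F a)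
  refine (hasFDerivAt_F a z).congr_fderiv ?_
  ext <;> rfl

/-! ### The type of the fixed points -/

theorem charpoly_fderiv_F {a : ℝ} {z : ℝ × ℝ} {l m : ℝ}
    (htrace : (1 + 2 * a * cos z.1) + (1 + 2 * a * cos z.2) = l + m)
    (hdet : (1 + 2 * a * cos z.1) * (1 + 2 * a * cos z.2) - (a * cos z.2) * (a * cos z.1)
      = l * m) :
    (fderiv ℝ (F a) z : (ℝ × ℝ) →ₗ[ℝ] (ℝ × ℝ)).charpoly =
      (Polynomial.X - Polynomial.C l) * (Polynomial.X - Polynomial.C m) := by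
  have hchar : (fderiv ℝ (F a) z : (ℝ × ℝ) →ₗ[ℝ] (ℝ × ℝ)).charpoly =
      Polynomial.X ^ 2 - Polynomial.C (l + m) * Polynomial.X + Polynomial.C (l * m) := by
    rw [(hasFDerivAt_F a z).fderiv, ← LinearMap.charpoly_toMatrix _ (Module.Basis.finTwoProd ℝ),
      Matrix.charpoly_fin_two, Matrix.trace_fin_two, Matrix.det_fin_two, ← htrace, ← hdet]
    simp [LinearMap.toMatrix_apply, dF_apply]
  rw [hchar, Polynomial.C_add, Polynomial.C_mul]
  ring

theorem isUnstableNode_of_cos_eq_one {a : ℝ} (ha0 : 0 < a) {z : ℝ × ℝ} (hz : F a z = z)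
    (h₁ : cos z.1 = 1) (h₂ : cos z.2 = 1) : IsUnstableNode (F a) z := by
  refine ⟨hz, (hasFDerivAt_F a z).differentiableAt, 1 + a, 1 + 3 * a, ?_, ?_,
    charpoly_fderiv_F ?_ ?_⟩
  · exact lt_abs.2 (Or.inl (by linarith))
  · exact lt_abs.2 (Or.inl (by linarith))
  · rw [h₁, h₂]; ring
  · rw [h₁, h₂]; ring

theorem F_zero (a : ℝ) : F a (0, 0) = (0, 0) := by simp [F]

theorem F_saddle (a : ℝ) : F a (π, 0) = (π, 0) := by simp [F]

theorem F_two_pi (a : ℝ) : F a (2 * π, 0) = (2 * π, 0) := by simp [F]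

/-- The stable eigenvalue of `F a` at the saddle `(π, 0)`. -/
def stableEigenvalue (a : ℝ) : ℝ := 1 - √3 * a

theorem stableEigenvalue_mem_Ioo {a : ℝ} (ha : a ∈ Ioo (0 : ℝ) (1 / 3)) :
    stableEigenvalue a ∈ Ioo 0 1 := by
  have h₁ : 0 < √3 := by positivity
  have h₂ : √3 < 3 := (Real.sqrt_lt' (by norm_num)).2 (by norm_num)
  constructor <;> unfold stableEigenvalue <;> nlinarith [ha.1, ha.2]

theorem isSaddle_pi {a : ℝ} (ha : a ∈ Ioo (0 : ℝ) (1 / 3)) : IsSaddle (F a) (π, 0) := by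
  obtain ⟨hl0, hl1⟩ := stableEigenvalue_mem_Ioo ha
  have ha0 : 0 < √3 * a := mul_pos (by positivity) ha.1
  refine ⟨F_saddle a, (hasFDerivAt_F a _).differentiableAt, stableEigenvalue a, 1 + √3 * a, ?_,
    lt_abs.2 (Or.inl (by linarith)), charpoly_fderiv_F ?_ ?_⟩
  · rwa [abs_of_pos hl0]
  · simp only [cos_pi, cos_zero, stableEigenvalue]
    ring
  · simp only [cos_pi, cos_zero, stableEigenvalue]
    linear_combination a ^ 2 * Real.mul_self_sqrt (show (0 : ℝ) ≤ 3 by norm_num)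

/-! ### Diagonal coordinates -/

/-- Half the sum of the coordinates. Together with `halfDiff` it diagonalizes the linear part of
`F a` and turns the squares `S10`, `s1`, `s4` into products of intervals. -/
def halfSum (z : ℝ × ℝ) : ℝ := (z.1 + z.2) / 2

/-- Half the difference of the coordinates, the second diagonal coordinate. -/
def halfDiff (z : ℝ × ℝ) : ℝ := (z.1 - z.2) / 2

/-- The diagonal coordinates `(halfSum, halfDiff)` as a homeomorphism of the plane. -/
def diagHomeo : (ℝ × ℝ) ≃ₜ (ℝ × ℝ) where
  toFun z := (halfSum z, halfDiff z)
  invFun w := (w.1 + w.2, w.1 - w.2)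
  left_inv z := by ext <;> simp [halfSum, halfDiff] <;> ring
  right_inv w := by ext <;> simp [halfSum, halfDiff]
  continuous_toFun := by unfold halfSum halfDiff; fun_prop
  continuous_invFun := by fun_prop

theorem continuous_halfSum : Continuous halfSum := by unfold halfSum; fun_prop

theorem continuous_halfDiff : Continuous halfDiff := by unfold halfDiff; fun_prop

theorem fst_eq_halfSum_add_halfDiff (z : ℝ × ℝ) : z.1 = halfSum z + halfDiff z := by
  unfold halfSum halfDiff; ring

theorem snd_eq_halfSum_sub_halfDiff (z : ℝ × ℝ) : z.2 = halfSum z - halfDiff z := by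
  unfold halfSum halfDiff; ring

theorem ext_diag {z w : ℝ × ℝ} (hu : halfSum z = halfSum w) (hv : halfDiff z = halfDiff w) :
    z = w :=
  diagHomeo.injective (Prod.ext hu hv)

/-- A component of `F a` in diagonal coordinates. -/
def diagMap (k u v : ℝ) : ℝ := u + k * (sin u * cos v)

theorem halfSum_F (a : ℝ) (z : ℝ × ℝ) :
    halfSum (F a z) = diagMap (3 * a) (halfSum z) (halfDiff z) := by
  have h : halfSum (F a z) = halfSum z + 3 * a * ((sin z.1 + sin z.2) / 2) := by
    simp only [halfSum, F]; ring
  rw [h, fst_eq_halfSum_add_halfDiff z, snd_eq_halfSum_sub_halfDiff z, sin_add, sin_sub, diagMap]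
  ring

theorem halfDiff_F (a : ℝ) (z : ℝ × ℝ) :
    halfDiff (F a z) = diagMap a (halfDiff z) (halfSum z) := by
  have h : halfDiff (F a z) = halfDiff z + a * ((sin z.1 - sin z.2) / 2) := by
    simp only [halfDiff, F]; ring
  rw [h, fst_eq_halfSum_add_halfDiff z, snd_eq_halfSum_sub_halfDiff z, sin_add, sin_sub, diagMap]
  ring

theorem mem_S10 {z : ℝ × ℝ} : z ∈ S10 ↔ halfSum z ∈ Icc 0 π ∧ halfDiff z ∈ Icc 0 π := by
  simp only [S10, halfSum, halfDiff, mem_ofPred_eq, mem_Icc]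
  constructor <;> rintro ⟨⟨h₁, h₂⟩, h₃, h₄⟩ <;> refine ⟨⟨?_, ?_⟩, ?_, ?_⟩ <;> linarith

theorem mem_s1 {z : ℝ × ℝ} :
    z ∈ s1 ↔ halfSum z ∈ Icc 0 (π / 2) ∧ halfDiff z ∈ Icc 0 (π / 2) := by
  simp only [s1, halfSum, halfDiff, mem_ofPred_eq, mem_Icc]
  constructor <;> rintro ⟨⟨h₁, h₂⟩, h₃, h₄⟩ <;> refine ⟨⟨?_, ?_⟩, ?_, ?_⟩ <;> linarith

theorem mem_s4 {z : ℝ × ℝ} :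
    z ∈ s4 ↔ halfSum z ∈ Icc (π / 2) π ∧ halfDiff z ∈ Icc (π / 2) π := by
  simp only [s4, halfSum, halfDiff, mem_ofPred_eq, mem_Icc]
  constructor <;> rintro ⟨⟨h₁, h₂⟩, h₃, h₄⟩ <;> refine ⟨⟨?_, ?_⟩, ?_, ?_⟩ <;> linarith

theorem mem_interior_diag_iff {s : Set (ℝ × ℝ)} {α β : ℝ}
    (hs : ∀ {z}, z ∈ s ↔ halfSum z ∈ Icc α β ∧ halfDiff z ∈ Icc α β) {z : ℝ × ℝ} :
    z ∈ interior s ↔ halfSum z ∈ Ioo α β ∧ halfDiff z ∈ Ioo α β := by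
  have : s = diagHomeo ⁻¹' (Icc α β ×ˢ Icc α β) := Set.ext fun z => hs
  rw [this, ← Homeomorph.preimage_interior, interior_prod_eq, interior_Icc]
  rfl

theorem mem_interior_S10 {z : ℝ × ℝ} :
    z ∈ interior S10 ↔ halfSum z ∈ Ioo 0 π ∧ halfDiff z ∈ Ioo 0 π :=
  mem_interior_diag_iff mem_S10

theorem mem_interior_s1 {z : ℝ × ℝ} :
    z ∈ interior s1 ↔ halfSum z ∈ Ioo 0 (π / 2) ∧ halfDiff z ∈ Ioo 0 (π / 2) :=
  mem_interior_diag_iff mem_s1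

theorem mem_interior_s4 {z : ℝ × ℝ} :
    z ∈ interior s4 ↔ halfSum z ∈ Ioo (π / 2) π ∧ halfDiff z ∈ Ioo (π / 2) π :=
  mem_interior_diag_iff mem_s4

theorem halfSum_saddle : halfSum (π, 0) = π / 2 := by simp [halfSum]

theorem halfDiff_saddle : halfDiff (π, 0) = π / 2 := by simp [halfDiff]

theorem halfSum_rot (z : ℝ × ℝ) : halfSum (rot z) = π - halfSum z := by
  simp only [halfSum, rot]; ring

theorem halfDiff_rot (z : ℝ × ℝ) : halfDiff (rot z) = π - halfDiff z := by
  simp only [halfDiff, rot]; ring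

theorem rot_involutive : Function.Involutive rot := fun z => by simp [rot]

/-! ### Invariance of the squares -/

theorem diagMap_neg (k u v : ℝ) : diagMap k (-u) v = -diagMap k u v := by
  simp only [diagMap, sin_neg]; ring

theorem diagMap_pi_sub (k u v : ℝ) : diagMap k (π - u) (π - v) = π - diagMap k u v := by
  simp only [diagMap, sin_pi_sub, cos_pi_sub]; ring

theorem diagMap_pos_of_pos {k u : ℝ} (hk : |k| < 1) (hu : 0 < u) (v : ℝ) : 0 < diagMap k u v := by
  have hs : |k * (sin u * cos v)| ≤ |k| * u := by
    rw [abs_mul, abs_mul]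
    gcongr
    exact (mul_le_of_le_one_right (abs_nonneg _) (abs_cos_le_one v)).trans
      (abs_sin_le_abs.trans_eq (abs_of_pos hu))
  have : |k| * u < u := mul_lt_of_lt_one_left hu hk
  unfold diagMap
  linarith [(abs_le.1 hs).1]

theorem diagMap_pos_iff {k : ℝ} (hk : |k| < 1) (u v : ℝ) : 0 < diagMap k u v ↔ 0 < u := by
  refine ⟨fun h => ?_, fun h => diagMap_pos_of_pos hk h v⟩
  rcases lt_trichotomy u 0 with hu | rfl | hu
  · have := diagMap_pos_of_pos hk (neg_pos.2 hu) v
    rw [diagMap_neg] at this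
    linarith
  · simp [diagMap] at h
  · exact hu

theorem diagMap_nonneg_iff {k : ℝ} (hk : |k| < 1) (u v : ℝ) : 0 ≤ diagMap k u v ↔ 0 ≤ u := by
  have := diagMap_pos_iff hk (-u) v
  rw [diagMap_neg, neg_pos, neg_pos] at this
  rw [← not_lt, ← not_lt, this]

theorem diagMap_mem_Ioo_iff {k : ℝ} (hk : |k| < 1) (u v : ℝ) :
    diagMap k u v ∈ Ioo 0 π ↔ u ∈ Ioo 0 π := by
  have := diagMap_pos_iff hk (π - u) (π - v)
  rw [diagMap_pi_sub, sub_pos, sub_pos] at this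
  rw [mem_Ioo, mem_Ioo, diagMap_pos_iff hk, this]

theorem diagMap_mem_Icc_iff {k : ℝ} (hk : |k| < 1) (u v : ℝ) :
    diagMap k u v ∈ Icc 0 π ↔ u ∈ Icc 0 π := by
  have := diagMap_nonneg_iff hk (π - u) (π - v)
  rw [diagMap_pi_sub, sub_nonneg, sub_nonneg] at this
  rw [mem_Icc, mem_Icc, diagMap_nonneg_iff hk, this]

theorem F_rot (a : ℝ) (z : ℝ × ℝ) : F a (rot z) = rot (F a z) := by
  refine ext_diag ?_ ?_
  · rw [halfSum_F, halfSum_rot, halfSum_rot, halfDiff_rot, halfSum_F, diagMap_pi_sub]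
  · rw [halfDiff_F, halfDiff_rot, halfSum_rot, halfDiff_rot, halfDiff_F, diagMap_pi_sub]

theorem abs_three_mul_lt_one {a : ℝ} (ha : |a| < 1 / 3) : |3 * a| < 1 := by
  rw [abs_mul, abs_of_pos three_pos]
  linarith

theorem F_preimage_S10 {a : ℝ} (ha : |a| < 1 / 3) : F a ⁻¹' S10 = S10 := by
  ext z
  rw [mem_preimage, mem_S10, mem_S10, halfSum_F, halfDiff_F,
    diagMap_mem_Icc_iff (abs_three_mul_lt_one ha), diagMap_mem_Icc_iff (by linarith)]

theorem F_preimage_interior_S10 {a : ℝ} (ha : |a| < 1 / 3) :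
    F a ⁻¹' interior S10 = interior S10 := by
  ext z
  rw [mem_preimage, mem_interior_S10, mem_interior_S10, halfSum_F, halfDiff_F,
    diagMap_mem_Ioo_iff (abs_three_mul_lt_one ha), diagMap_mem_Ioo_iff (by linarith)]

/-! ### The stable curve of the saddle -/

/-- The `ℂ`-linear endomorphism of `ℂ × ℂ` with the real matrix `!![p, q; r, s]`. -/
def realMatrixCLM (p q r s : ℝ) : (ℂ × ℂ) →L[ℂ] (ℂ × ℂ) :=
  ((p : ℂ) • ContinuousLinearMap.fst ℂ ℂ ℂ + (q : ℂ) • ContinuousLinearMap.snd ℂ ℂ ℂ).prod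
    ((r : ℂ) • ContinuousLinearMap.fst ℂ ℂ ℂ + (s : ℂ) • ContinuousLinearMap.snd ℂ ℂ ℂ)

theorem realMatrixCLM_apply (p q r s : ℝ) (w : ℂ × ℂ) :
    realMatrixCLM p q r s w = (p * w.1 + q * w.2, r * w.1 + s * w.2) := by
  simp [realMatrixCLM]

theorem norm_realMatrixCLM_le {p q r s K : ℝ} (h₁ : |p| + |q| ≤ K) (h₂ : |r| + |s| ≤ K) :
    ‖realMatrixCLM p q r s‖ ≤ K := by
  have hrow : ∀ {x y : ℝ}, |x| + |y| ≤ K → ∀ w : ℂ × ℂ, ‖(x * w.1 + y * w.2 : ℂ)‖ ≤ K * ‖w‖ :=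
    fun {x y} h w => calc
      ‖(x * w.1 + y * w.2 : ℂ)‖ ≤ |x| * ‖w.1‖ + |y| * ‖w.2‖ := by
        simpa using norm_add_le (x * w.1 : ℂ) (y * w.2)
      _ ≤ |x| * ‖w‖ + |y| * ‖w‖ := by gcongr; exacts [norm_fst_le w, norm_snd_le w]
      _ ≤ K * ‖w‖ := by rw [← add_mul]; gcongr
  have hK : 0 ≤ K := (by positivity : 0 ≤ |p| + |q|).trans h₁
  refine ContinuousLinearMap.opNorm_le_bound _ hK fun w => ?_
  rw [realMatrixCLM_apply]
  exact norm_prod_le_iff.2 ⟨hrow h₁ w, hrow h₂ w⟩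

/-- The complexification of `F a`, with the saddle `(π, 0)` translated to the origin. -/
def saddleMap (a : ℝ) (w : ℂ × ℂ) : ℂ × ℂ :=
  (w.1 - 2 * a * Complex.sin w.1 + a * Complex.sin w.2,
    w.2 - a * Complex.sin w.1 + 2 * a * Complex.sin w.2)

/-- The derivative of `saddleMap a` at the origin. -/
def saddleDeriv {a : ℝ} (ha : 1 - 3 * a ^ 2 ≠ 0) : (ℂ × ℂ) ≃L[ℂ] (ℂ × ℂ) :=
  ContinuousLinearEquiv.equivOfInverse (realMatrixCLM (1 - 2 * a) a (-a) (1 + 2 * a))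
    (realMatrixCLM ((1 + 2 * a) / (1 - 3 * a ^ 2)) (-a / (1 - 3 * a ^ 2)) (a / (1 - 3 * a ^ 2))
      ((1 - 2 * a) / (1 - 3 * a ^ 2)))
    (fun w => by
      have : (1 - 3 * a ^ 2 : ℂ) ≠ 0 := mod_cast ha
      refine Prod.ext ?_ ?_ <;> simp only [realMatrixCLM_apply] <;> push_cast
      · linear_combination w.1 * mul_inv_cancel₀ this
      · linear_combination w.2 * mul_inv_cancel₀ this)
    (fun w => by
      have : (1 - 3 * a ^ 2 : ℂ) ≠ 0 := mod_cast ha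
      refine Prod.ext ?_ ?_ <;> simp only [realMatrixCLM_apply] <;> push_cast
      · linear_combination w.1 * mul_inv_cancel₀ this
      · linear_combination w.2 * mul_inv_cancel₀ this)

theorem saddleDeriv_apply {a : ℝ} (ha : 1 - 3 * a ^ 2 ≠ 0) (w : ℂ × ℂ) :
    saddleDeriv ha w = ((1 - 2 * a) * w.1 + a * w.2, -a * w.1 + (1 + 2 * a) * w.2) := by
  simp [saddleDeriv, realMatrixCLM_apply]

theorem norm_saddleDeriv_symm_le {a : ℝ} (ha0 : 0 ≤ a) (ha1 : a ≤ 1 / 2)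
    (ha : 1 - 3 * a ^ 2 ≠ 0) :
    ‖((saddleDeriv ha).symm : (ℂ × ℂ) →L[ℂ] (ℂ × ℂ))‖ ≤ (1 + 3 * a) / (1 - 3 * a ^ 2) := by
  have hdet : 0 ≤ 1 - 3 * a ^ 2 := by nlinarith
  refine norm_realMatrixCLM_le ?_ ?_ <;>
    rw [abs_div, abs_div, abs_of_nonneg hdet, ← add_div] <;>
    refine div_le_div_of_nonneg_right ?_ hdet
  · rw [abs_neg, abs_of_nonneg ha0, abs_of_nonneg (by linarith)]
    linarith
  · rw [abs_of_nonneg ha0, abs_of_nonneg (by linarith)]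
    linarith

theorem saddleMap_zero (a : ℝ) : saddleMap a 0 = 0 := by simp [saddleMap]

theorem contDiff_saddleMap (a : ℝ) : ContDiff ℂ 2 (saddleMap a) := by
  unfold saddleMap
  fun_prop

theorem hasFDerivAt_saddleMap {a : ℝ} (ha : 1 - 3 * a ^ 2 ≠ 0) :
    HasFDerivAt (saddleMap a) (saddleDeriv ha : (ℂ × ℂ) →L[ℂ] (ℂ × ℂ)) 0 := by
  have h₁ : HasFDerivAt Prod.fst (ContinuousLinearMap.fst ℂ ℂ ℂ) (0 : ℂ × ℂ) := hasFDerivAt_fst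
  have h₂ : HasFDerivAt Prod.snd (ContinuousLinearMap.snd ℂ ℂ ℂ) (0 : ℂ × ℂ) := hasFDerivAt_snd
  have h := ((h₁.sub (h₁.csin.const_mul (2 * (a : ℂ)))).add (h₂.csin.const_mul (a : ℂ))).prodMk
    ((h₂.sub (h₁.csin.const_mul (a : ℂ))).add (h₂.csin.const_mul (2 * (a : ℂ))))
  refine h.congr_fderiv ?_
  ext <;> simp [saddleDeriv_apply]

theorem saddleDeriv_stable_direction {a : ℝ} (ha : 1 - 3 * a ^ 2 ≠ 0) :
    saddleDeriv ha (((2 + √3 : ℝ) : ℂ), 1) =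
      (stableEigenvalue a : ℂ) • (((2 + √3 : ℝ) : ℂ), (1 : ℂ)) := by
  have h3 : (√3 : ℂ) * √3 = 3 := mod_cast Real.mul_self_sqrt (show (0 : ℝ) ≤ 3 by norm_num)
  rw [saddleDeriv_apply, stableEigenvalue]
  refine Prod.ext ?_ ?_ <;> simp only [Prod.smul_mk, smul_eq_mul] <;> push_cast
  · linear_combination (a : ℂ) * h3
  · ring

theorem norm_saddleDeriv_symm_mul_sq_lt_one {a : ℝ} (ha : a ∈ Ioo (0 : ℝ) (1 / 3))
    (ha' : 1 - 3 * a ^ 2 ≠ 0) :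
    ‖((saddleDeriv ha').symm : (ℂ × ℂ) →L[ℂ] (ℂ × ℂ))‖ * stableEigenvalue a ^ 2 < 1 := by
  obtain ⟨ha0, ha1⟩ := ha
  obtain ⟨hl0, -⟩ := stableEigenvalue_mem_Ioo ⟨ha0, ha1⟩
  have h3 : √3 * √3 = 3 := Real.mul_self_sqrt (by norm_num)
  have hD : 0 < 1 - 3 * a ^ 2 := by nlinarith
  have hfac : 1 - 3 * a ^ 2 = stableEigenvalue a * (1 + √3 * a) := by
    unfold stableEigenvalue
    linear_combination a ^ 2 * h3
  have hlt : (1 + 3 * a) * stableEigenvalue a < 1 + √3 * a := by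
    have h32 : 3 / 2 < √3 := Real.lt_sqrt_of_sq_lt (by norm_num)
    unfold stableEigenvalue
    nlinarith [mul_pos ha0 (by positivity : 0 < √3 * a)]
  calc _ ≤ (1 + 3 * a) / (1 - 3 * a ^ 2) * stableEigenvalue a ^ 2 := by
        gcongr
        exact norm_saddleDeriv_symm_le ha0.le (by linarith) ha'
    _ = stableEigenvalue a * ((1 + 3 * a) * stableEigenvalue a) / (1 - 3 * a ^ 2) := by ring
    _ < stableEigenvalue a * (1 + √3 * a) / (1 - 3 * a ^ 2) := by gcongr
    _ = 1 := by rw [← hfac, div_self ha']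

theorem exists_complex_stable_curve {a : ℝ} (ha : a ∈ Ioo (0 : ℝ) (1 / 3)) :
    ∃ ρ > 0, ∃ Φ : ℂ → ℂ × ℂ, DifferentiableOn ℂ Φ (Metric.ball 0 ρ) ∧
      HasDerivAt Φ (((2 + √3 : ℝ) : ℂ), 1) 0 ∧
      ∀ t ∈ Metric.ball (0 : ℂ) ρ, saddleMap a (Φ t) = Φ (stableEigenvalue a * t) ∧
        Φ (-t) = -Φ t ∧ Φ (star t) = star (Φ t) := by
  obtain ⟨hl0, hl1⟩ := stableEigenvalue_mem_Ioo ha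
  have ha' : 1 - 3 * a ^ 2 ≠ 0 := by nlinarith [ha.1, ha.2]
  have hl : ‖(stableEigenvalue a : ℂ)‖ = stableEigenvalue a := by
    rw [Complex.norm_real, Real.norm_of_nonneg hl0.le]
  obtain ⟨ρ, hρ, Φ, hdiff, hderiv, hmap, hsymm⟩ := exists_linearizing_curve (contDiff_saddleMap a)
    (saddleMap_zero a) (hasFDerivAt_saddleMap ha') (hl.trans_le hl1.le)
    (by rw [hl]; exact norm_saddleDeriv_symm_mul_sq_lt_one ha ha')
    (saddleDeriv_stable_direction ha')
  refine ⟨ρ, hρ, Φ, hdiff, hderiv, fun t ht => ⟨hmap t ht, ?_, ?_⟩⟩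
  · refine hsymm negAddMonoidHom Neg.neg continuous_neg (fun w => ?_) (fun w => by simp)
      (fun t => by simp) (fun t => by simp) t ht (by simpa using ht)
    ext <;> simp [saddleMap] <;> ring
  · refine hsymm (starAddEquiv : ℂ × ℂ ≃+ ℂ × ℂ) star continuous_star (fun w => ?_) (fun w => ?_)
      (fun t => by simp) (fun t => ?_) t ht (by simpa using ht)
    · ext <;> simp [saddleMap, ← Complex.sin_conj]
    · ext <;> simp [saddleDeriv_apply]
    · ext <;> simp

/-- The real part of a point of `ℂ × ℂ`, in the coordinates of the plane in which the saddle is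
`(π, 0)`. -/
def realPart (w : ℂ × ℂ) : ℝ × ℝ := (π, 0) + Complex.reCLM.prodMap Complex.reCLM w

theorem realPart_neg (w : ℂ × ℂ) : realPart (-w) = rot (realPart w) := by
  refine Prod.ext ?_ ?_
  · change π + -w.1.re = 2 * π - (π + w.1.re)
    ring
  · change 0 + -w.2.re = -(0 + w.2.re)
    ring

theorem F_realPart (a : ℝ) {w : ℂ × ℂ} (hw : star w = w) :
    F a (realPart w) = realPart (saddleMap a w) := by
  obtain ⟨x, hx⟩ := Complex.conj_eq_iff_real.1 (congrArg Prod.fst hw)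
  obtain ⟨y, hy⟩ := Complex.conj_eq_iff_real.1 (congrArg Prod.snd hw)
  obtain rfl : w = (↑x, ↑y) := Prod.ext hx hy
  have hre (x y : ℝ) : realPart (x, y) = (π + x, y) := by
    ext <;> simp [realPart]
  have hmap : saddleMap a (x, y) =
      (((x - 2 * a * sin x + a * sin y : ℝ) : ℂ), ((y - a * sin x + 2 * a * sin y : ℝ) : ℂ)) := by
    ext <;> simp [saddleMap]
  rw [hmap, hre, hre, F, add_comm π x, sin_add_pi]
  ext <;> ring

theorem exists_local_stable_curve {a : ℝ} (ha : a ∈ Ioo (0 : ℝ) (1 / 3)) :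
    ∃ ρ > 0, ∃ φ : ℝ → ℝ × ℝ, ContDiffOn ℝ ∞ φ (Ioo (-ρ) ρ) ∧ HasDerivAt φ (2 + √3, 1) 0 ∧
      ∀ t ∈ Ioo (-ρ) ρ, φ (-t) = rot (φ t) ∧ φ (stableEigenvalue a * t) = F a (φ t) := by
  obtain ⟨ρ, hρ, Φ, hdiff, hderiv, hΦ⟩ := exists_complex_stable_curve ha
  have hmem : ∀ t ∈ Ioo (-ρ) ρ, (t : ℂ) ∈ Metric.ball (0 : ℂ) ρ := fun t ht => by
    rw [mem_ball_zero_iff, Complex.norm_real, Real.norm_eq_abs, abs_lt]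
    exact ht
  refine ⟨ρ, hρ, fun t => realPart (Φ t), ?_, ?_, fun t ht => ⟨?_, ?_⟩⟩
  · have hreal : ContDiffOn ℝ ∞ Φ (Metric.ball 0 ρ) :=
      (hdiff.contDiffOn Metric.isOpen_ball).restrict_scalars ℝ
    exact contDiffOn_const.add ((ContinuousLinearMap.contDiff _).comp_contDiffOn
      (hreal.comp Complex.ofRealCLM.contDiff.contDiffOn hmem))
  · have hcurve : HasDerivAt (fun t : ℝ => Φ t) (((2 + √3 : ℝ) : ℂ), 1) 0 := by
      have h₀ : HasDerivAt Φ (((2 + √3 : ℝ) : ℂ), 1) (Complex.ofRealCLM 0) := by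
        rwa [map_zero]
      exact (h₀.scomp (0 : ℝ) Complex.ofRealCLM.hasDerivAt).congr_deriv (by simp)
    exact ((Complex.reCLM.prodMap Complex.reCLM).hasFDerivAt.comp_hasDerivAt 0
      hcurve).const_add ((π, 0) : ℝ × ℝ) |>.congr_deriv (by ext <;> simp)
  · obtain ⟨-, hneg, -⟩ := hΦ t (hmem t ht)
    simp only [Complex.ofReal_neg, hneg, realPart_neg]
  · obtain ⟨hmap, -, hstar⟩ := hΦ t (hmem t ht)
    simp only [Complex.ofReal_mul, ← hmap]
    exact (F_realPart a (by simpa using hstar.symm)).symm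

/-- A smooth curve through the saddle `(π, 0)`, tangent there to the stable direction, symmetric
under `rot`, on which `F a` multiplies the parameter by the stable eigenvalue. -/
structure IsStableCurve (a : ℝ) (c : ℝ → ℝ × ℝ) : Prop where
  smooth : IsSmoothCurve c
  hasDerivAt : HasDerivAt c (2 + √3, 1) 0
  neg : ∀ t, c (-t) = rot (c t)
  semiconj : Function.Semiconj c (stableEigenvalue a * ·) (F a)

theorem eq_saddle_of_rot_eq {z : ℝ × ℝ} (h : rot z = z) : z = (π, 0) := by
  have h₁ : 2 * π - z.1 = z.1 := congrArg Prod.fst h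
  have h₂ : -z.2 = z.2 := congrArg Prod.snd h
  exact Prod.ext (by simp only; linarith) (by simp only; linarith)

theorem IsStableCurve.zero {a : ℝ} {c : ℝ → ℝ × ℝ} (hc : IsStableCurve a c) : c 0 = (π, 0) :=
  eq_saddle_of_rot_eq (by simpa using (hc.neg 0).symm)

theorem abs_lt_of_mem_Ioo {x r : ℝ} (hx : x ∈ Ioo 0 r) : |x| < r :=
  (abs_of_pos hx.1).trans_lt hx.2

theorem comp_neg_eq_rot_comp {a : ℝ} (ha : a ∈ Ioo (0 : ℝ) (1 / 3)) {c : ℝ → ℝ × ℝ}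
    (h : Function.Semiconj c (stableEigenvalue a * ·) (F a))
    (hc : ∀ᶠ t in 𝓝 0, c (-t) = rot (c t)) (t : ℝ) : c (-t) = rot (c t) := by
  obtain ⟨hl0, hl1⟩ := stableEigenvalue_mem_Ioo ha
  obtain ⟨n, hn⟩ := ((tendsto_pow_mul_nhds_zero hl0.le hl1 t).eventually hc).exists
  apply (homeoF (abs_lt_of_mem_Ioo ha)).injective.iterate n
  change (F a)^[n] _ = (F a)^[n] _
  have hrot : (F a)^[n] (rot (c t)) = rot ((F a)^[n] (c t)) :=
    Function.Commute.iterate_left (F_rot a) n (c t)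
  rw [hrot, iterate_of_semiconj_mul h, iterate_of_semiconj_mul h, mul_neg, hn]

theorem exists_isStableCurve {a : ℝ} (ha : a ∈ Ioo (0 : ℝ) (1 / 3)) :
    ∃ c : ℝ → ℝ × ℝ, IsStableCurve a c := by
  obtain ⟨ρ, hρ, φ, hφs, hφd, hφ⟩ := exists_local_stable_curve ha
  obtain ⟨hl0, hl1⟩ := stableEigenvalue_mem_Ioo ha
  have hF := abs_lt_of_mem_Ioo ha
  obtain ⟨c, hcφ, hc⟩ := exists_semiconj_eqOn (homeoF hF).toEquiv hl0.le hl1 hρ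
    fun t ht => (hφ t ht).2
  change Function.Semiconj c _ (F a) at hc
  have hI : Ioo (-ρ) ρ ∈ 𝓝 (0 : ℝ) := Ioo_mem_nhds (neg_lt_zero.2 hρ) hρ
  have hcd : HasDerivAt c (2 + √3, 1) 0 :=
    hφd.congr_of_eventuallyEq (eventually_of_mem hI hcφ)
  have hcs : ContDiff ℝ ∞ c := by
    refine contDiff_of_semiconj_mul hc (contDiff_homeoF_symm hF) (homeoF hF).symm_apply_apply
      hl0.le hl1 ?_
    filter_upwards [isOpen_Ioo.mem_nhds (mem_of_mem_nhds hI)] with t ht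
    exact (hφs.contDiffAt (isOpen_Ioo.mem_nhds ht)).congr_of_eventuallyEq
      (eventually_of_mem (isOpen_Ioo.mem_nhds ht) hcφ)
  refine ⟨c, isSmoothCurve_of_semiconj_mul hc hl0 hl1 ((contDiff_F a).differentiable (by simp)) hcs
    fun h => ?_, hcd, comp_neg_eq_rot_comp ha hc ?_, hc⟩
  · rw [hcd.deriv] at h
    exact one_ne_zero (congrArg Prod.snd h)
  · filter_upwards [hI] with t ht
    have ht' : -t ∈ Ioo (-ρ) ρ := ⟨neg_lt_neg ht.2, neg_lt.1 ht.1⟩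
    rw [hcφ ht, hcφ ht', (hφ t ht).1]

/-! ### The cone order -/

/-- The partial order on the plane whose positive cone is the closed upward quadrant
`|x| ≤ y`. The map `F a` preserves it on `S10`, and the stable set of the saddle is an antichain. -/
def ConeLE (z w : ℝ × ℝ) : Prop := |w.1 - z.1| ≤ w.2 - z.2

theorem coneLE_of_fst_eq {z w : ℝ × ℝ} (h₁ : z.1 = w.1) (h₂ : z.2 ≤ w.2) : ConeLE z w := by
  simpa [ConeLE, h₁] using h₂

theorem coneLE_iff_diag {z w : ℝ × ℝ} :
    ConeLE z w ↔ halfSum z ≤ halfSum w ∧ halfDiff w ≤ halfDiff z := by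
  rw [ConeLE, abs_le, halfSum, halfSum, halfDiff, halfDiff]
  constructor <;> rintro ⟨h₁, h₂⟩ <;> constructor <;> linarith

theorem monotone_diagMap {k : ℝ} (hk : |k| ≤ 1) (v : ℝ) : Monotone fun u => diagMap k u v := by
  intro u₁ u₂ hu
  have h : |k * ((sin u₁ - sin u₂) * cos v)| ≤ u₂ - u₁ := calc
    |k * ((sin u₁ - sin u₂) * cos v)| = |k| * (|sin u₁ - sin u₂| * |cos v|) := by
      rw [abs_mul, abs_mul]
    _ ≤ 1 * (|u₁ - u₂| * 1) := by
      have hsin := abs_sin_sub_sin_le u₁ u₂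
      have hcos := abs_cos_le_one v
      exact mul_le_mul hk (mul_le_mul hsin hcos (abs_nonneg _) (abs_nonneg _))
        (by positivity) zero_le_one
    _ = u₂ - u₁ := by rw [one_mul, mul_one, abs_sub_comm, abs_of_nonneg (sub_nonneg.2 hu)]
  simp only [diagMap]
  linarith [(abs_le.1 h).2]

theorem antitoneOn_diagMap {k u : ℝ} (hk : 0 ≤ k) (hu : u ∈ Icc 0 π) :
    AntitoneOn (diagMap k u) (Icc 0 π) := by
  intro v₁ hv₁ v₂ hv₂ hv
  have hs : 0 ≤ sin u := sin_nonneg_of_mem_Icc hu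
  have hc : cos v₂ ≤ cos v₁ := antitoneOn_cos hv₁ hv₂ hv
  unfold diagMap
  gcongr

theorem diagMap_le_diagMap {k u₁ u₂ v₁ v₂ : ℝ} (hk : k ∈ Icc (0 : ℝ) 1) (hu₂ : u₂ ∈ Icc 0 π)
    (hv₁ : v₁ ∈ Icc 0 π) (hv₂ : v₂ ∈ Icc 0 π) (hu : u₁ ≤ u₂) (hv : v₂ ≤ v₁) :
    diagMap k u₁ v₁ ≤ diagMap k u₂ v₂ :=
  (monotone_diagMap (abs_le.2 ⟨by linarith [hk.1], hk.2⟩) v₁ hu).trans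
    (antitoneOn_diagMap hk.1 hu₂ hv₂ hv₁ hv)

section ConeOrder

variable {a : ℝ}

theorem ConeLE.map_F (ha : a ∈ Icc (0 : ℝ) (1 / 3)) {z w : ℝ × ℝ} (hz : z ∈ S10) (hw : w ∈ S10)
    (h : ConeLE z w) : ConeLE (F a z) (F a w) := by
  obtain ⟨ha0, ha1⟩ := ha
  rw [mem_S10] at hz hw
  rw [coneLE_iff_diag] at h
  rw [coneLE_iff_diag, halfSum_F, halfSum_F, halfDiff_F, halfDiff_F]
  exact ⟨diagMap_le_diagMap ⟨by linarith, by linarith⟩ hw.1 hz.2 hw.2 h.1 h.2,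
    diagMap_le_diagMap ⟨ha0, by linarith⟩ hz.2 hw.1 hz.1 h.2 h.1⟩

theorem half_le_cos_of_mem_Icc {x : ℝ} (hx : x ∈ Icc (-(π / 3)) (π / 3)) : 1 / 2 ≤ cos x := by
  rw [← cos_pi_div_three, ← cos_abs x]
  exact cos_le_cos_of_nonneg_of_le_pi (abs_nonneg x) (by linarith [pi_pos]) (abs_le.2 hx)

theorem half_mul_sub_le_sin_sub_sin {x y : ℝ} (hx : x ∈ Icc (-(π / 3)) (π / 3))
    (hy : y ∈ Icc (-(π / 3)) (π / 3)) (hxy : x ≤ y) : 1 / 2 * (y - x) ≤ sin y - sin x := by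
  refine (convex_Icc _ _).mul_sub_le_image_sub_of_le_deriv continuous_sin.continuousOn
    differentiable_sin.differentiableOn (fun t ht => ?_) x hx y hy hxy
  rw [Real.deriv_sin]
  exact half_le_cos_of_mem_Icc (interior_subset ht)

-- On the cone the growth `2 a Δ(sin y) ≥ a Δy` outweighs `a |Δ(sin x)| ≤ a |Δx| ≤ a Δy`.
theorem ConeLE.snd_sub_snd_le (ha : 0 ≤ a) {z w : ℝ × ℝ} (hz : z.2 ∈ Icc (-(π / 3)) (π / 3))
    (hw : w.2 ∈ Icc (-(π / 3)) (π / 3)) (h : ConeLE z w) :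
    w.2 - z.2 ≤ (F a w).2 - (F a z).2 := by
  have hzw : z.2 ≤ w.2 := sub_nonneg.1 ((abs_nonneg _).trans h)
  have hx : -(w.2 - z.2) ≤ sin w.1 - sin z.1 :=
    (abs_le.1 ((abs_sin_sub_sin_le w.1 z.1).trans h)).1
  have hy := half_mul_sub_le_sin_sub_sin hz hw hzw
  have hsum : 0 ≤ (sin w.1 - sin z.1) + 2 * (sin w.2 - sin z.2) := by linarith
  simp only [F]
  linarith [mul_nonneg ha hsum]

/-! ### The basin of the saddle -/

theorem basin_subset_interior_S10 (ha : |a| < 1 / 3) : basin (F a) (π, 0) ⊆ interior S10 := by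
  refine basin_subset_of_preimage_eq (F_preimage_interior_S10 ha) (isOpen_interior.mem_nhds ?_)
  rw [mem_interior_S10, halfSum_saddle, halfDiff_saddle]
  constructor <;> constructor <;> linarith [pi_pos]

theorem ConeLE.iterate_F (ha : a ∈ Ioo (0 : ℝ) (1 / 3)) {z w : ℝ × ℝ} (hz : z ∈ S10)
    (hw : w ∈ S10) (h : ConeLE z w) (n : ℕ) : ConeLE ((F a)^[n] z) ((F a)^[n] w) := by
  have hmaps : MapsTo (F a) S10 S10 := (F_preimage_S10 (abs_lt_of_mem_Ioo ha)).ge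
  induction n with
  | zero => exact h
  | succ n ih =>
    rw [Function.iterate_succ_apply', Function.iterate_succ_apply']
    exact ih.map_F (Ioo_subset_Icc_self ha) (hmaps.iterate n hz) (hmaps.iterate n hw)

-- The vertical distance of the two orbits eventually increases, yet tends to zero.
theorem eq_of_coneLE_of_mem_basin (ha : a ∈ Ioo (0 : ℝ) (1 / 3)) {z w : ℝ × ℝ}
    (hz : z ∈ basin (F a) (π, 0)) (hw : w ∈ basin (F a) (π, 0)) (h : ConeLE z w) : z = w := by
  have ha' := abs_lt_of_mem_Ioo ha
  have hle (n : ℕ) := h.iterate_F ha (interior_subset (basin_subset_interior_S10 ha' hz))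
    (interior_subset (basin_subset_interior_S10 ha' hw)) n
  have hlim {y} (hy : y ∈ basin (F a) (π, 0)) :
      Tendsto (fun n : ℕ => ((F a)^[n] y).2) atTop (𝓝 0) :=
    (continuous_snd.tendsto _).comp hy
  have hnhds : Icc (-(π / 3)) (π / 3) ∈ 𝓝 0 :=
    Icc_mem_nhds (by linarith [pi_pos]) (by linarith [pi_pos])
  obtain ⟨m, hm⟩ := eventually_atTop.1
    (((hlim hz).eventually hnhds).and ((hlim hw).eventually hnhds))
  let D (n : ℕ) : ℝ := ((F a)^[n + m] w).2 - ((F a)^[n + m] z).2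
  have hmono : Monotone D := monotone_nat_of_le_succ fun n => by
    obtain ⟨h₁, h₂⟩ := hm (n + m) (by omega)
    simp only [D, add_right_comm n 1 m, Function.iterate_succ_apply']
    exact (hle (n + m)).snd_sub_snd_le ha.1.le h₁ h₂
  have hD : Tendsto D atTop (𝓝 0) := by
    simpa using (tendsto_add_atTop_iff_nat m).2 ((hlim hw).sub (hlim hz))
  have hsnd : ((F a)^[m] w).2 - ((F a)^[m] z).2 ≤ 0 := by
    simpa [D] using hmono.ge_of_tendsto hD 0
  have hfst : |((F a)^[m] w).1 - ((F a)^[m] z).1| ≤ 0 := (hle m).trans hsnd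
  have hsnd' := (abs_nonneg _).trans (hle m)
  refine ((homeoF ha').injective.iterate m (Prod.ext ?_ ?_))
  · exact (sub_eq_zero.1 (abs_nonpos_iff.1 hfst)).symm
  · exact (sub_eq_zero.1 (le_antisymm hsnd hsnd')).symm

theorem abs_snd_sub_lt_of_mem_basin (ha : a ∈ Ioo (0 : ℝ) (1 / 3)) {z w : ℝ × ℝ}
    (hz : z ∈ basin (F a) (π, 0)) (hw : w ∈ basin (F a) (π, 0)) (hne : z ≠ w) :
    |z.2 - w.2| < |z.1 - w.1| := by
  by_contra! h
  rcases le_total z.2 w.2 with h' | h'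
  · refine hne (eq_of_coneLE_of_mem_basin ha hz hw ?_)
    rwa [abs_sub_comm, abs_sub_comm z.2, abs_of_nonneg (sub_nonneg.2 h')] at h
  · refine hne (eq_of_coneLE_of_mem_basin ha hw hz ?_).symm
    rwa [abs_of_nonneg (sub_nonneg.2 h')] at h

theorem injOn_fst_basin (ha : a ∈ Ioo (0 : ℝ) (1 / 3)) :
    InjOn Prod.fst (basin (F a) (π, 0)) := fun z hz w hw h => by
  by_contra hne
  have := abs_snd_sub_lt_of_mem_basin ha hz hw hne
  rw [h, sub_self, abs_zero] at this
  exact this.not_ge (abs_nonneg _)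

end ConeOrder

/-! ### The course of the stable curve -/

theorem eq_zero_of_diagMap_eq_self {k u v : ℝ} (hk : k ≠ 0) (hu : u ∈ Ioo (-π) π)
    (hv : v ∈ Ioo (-(π / 2)) (π / 2)) (h : diagMap k u v = u) : u = 0 := by
  have hsin : sin u = 0 := by
    simpa [diagMap, hk, (cos_pos_of_mem_Ioo hv).ne'] using h
  exact (sin_eq_zero_iff_of_lt_of_lt hu.1 hu.2).1 hsin

theorem eq_zero_of_F_eq_self {a : ℝ} (ha : a ≠ 0) {z : ℝ × ℝ} (hz : F a z = z)
    (hu : halfSum z ∈ Ioo (-(π / 2)) (π / 2)) (hv : halfDiff z ∈ Ioo (-(π / 2)) (π / 2)) :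
    z = (0, 0) := by
  have hsub : Ioo (-(π / 2)) (π / 2) ⊆ Ioo (-π) π :=
    Ioo_subset_Ioo (by linarith [pi_pos]) (by linarith [pi_pos])
  have hu0 : halfSum z = 0 := eq_zero_of_diagMap_eq_self (mul_ne_zero three_ne_zero ha)
    (hsub hu) hv (by rw [← halfSum_F, hz])
  have hv0 : halfDiff z = 0 := eq_zero_of_diagMap_eq_self ha (hsub hv) hu (by rw [← halfDiff_F, hz])
  exact ext_diag (hu0.trans (by simp [halfSum])) (hv0.trans (by simp [halfDiff]))

theorem fst_mem_Ioo_of_mem_interior_S10 {z : ℝ × ℝ} (hz : z ∈ interior S10) :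
    z.1 ∈ Ioo 0 (2 * π) := by
  obtain ⟨⟨hu0, hu1⟩, hv0, hv1⟩ := mem_interior_S10.1 hz
  rw [fst_eq_halfSum_add_halfDiff]
  constructor <;> linarith

theorem continuous_rot : Continuous rot := by unfold rot; fun_prop

namespace IsStableCurve

variable {a : ℝ} {c : ℝ → ℝ × ℝ}

theorem continuous (hc : IsStableCurve a c) : Continuous c := hc.smooth.1.continuous

theorem mem_basin (hc : IsStableCurve a c) (ha : a ∈ Ioo (0 : ℝ) (1 / 3)) (t : ℝ) :
    c t ∈ basin (F a) (π, 0) := by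
  obtain ⟨hl0, hl1⟩ := stableEigenvalue_mem_Ioo ha
  have h := (hc.continuous.tendsto 0).comp (tendsto_pow_mul_nhds_zero hl0.le hl1 t)
  rw [hc.zero] at h
  exact h.congr fun n => (iterate_of_semiconj_mul hc.semiconj n t).symm

theorem strictMono_fst (hc : IsStableCurve a c) (ha : a ∈ Ioo (0 : ℝ) (1 / 3)) :
    StrictMono fun t => (c t).1 := by
  have hinj : Function.Injective fun t => (c t).1 := fun s t h =>
    hc.smooth.2.1 (injOn_fst_basin ha (hc.mem_basin ha s) (hc.mem_basin ha t) h)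
  refine ((continuous_fst.comp hc.continuous).strictMono_of_inj hinj).resolve_right fun hanti => ?_
  have hd : HasDerivAt (fun t => (c t).1) (2 + √3) 0 :=
    (hasFDerivAt_fst (p := c 0)).comp_hasDerivAt (0 : ℝ) hc.hasDerivAt
  have hle : deriv (fun t => (c t).1) 0 ≤ 0 := hanti.antitone.deriv_nonpos
  rw [hd.deriv] at hle
  linarith [sqrt_nonneg 3]

theorem abs_snd_sub_lt (hc : IsStableCurve a c) (ha : a ∈ Ioo (0 : ℝ) (1 / 3)) {s t : ℝ}
    (h : s < t) : |(c t).2 - (c s).2| < (c t).1 - (c s).1 :=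
  (abs_snd_sub_lt_of_mem_basin ha (hc.mem_basin ha t) (hc.mem_basin ha s)
    (hc.smooth.2.1.ne h.ne')).trans_eq (abs_of_pos (sub_pos.2 (hc.strictMono_fst ha h)))

theorem strictMono_halfSum (hc : IsStableCurve a c) (ha : a ∈ Ioo (0 : ℝ) (1 / 3)) :
    StrictMono fun t => halfSum (c t) := fun s t h => by
  simp only [halfSum]
  linarith [(abs_lt.1 (hc.abs_snd_sub_lt ha h)).1]

theorem strictMono_halfDiff (hc : IsStableCurve a c) (ha : a ∈ Ioo (0 : ℝ) (1 / 3)) :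
    StrictMono fun t => halfDiff (c t) := fun s t h => by
  simp only [halfDiff]
  linarith [(abs_lt.1 (hc.abs_snd_sub_lt ha h)).2]

theorem mem_interior_S10 (hc : IsStableCurve a c) (ha : a ∈ Ioo (0 : ℝ) (1 / 3)) (t : ℝ) :
    c t ∈ interior S10 :=
  basin_subset_interior_S10 (abs_lt_of_mem_Ioo ha) (hc.mem_basin ha t)

theorem mem_interior_s1 (hc : IsStableCurve a c) (ha : a ∈ Ioo (0 : ℝ) (1 / 3)) {t : ℝ}
    (ht : t < 0) : c t ∈ interior s1 := by
  obtain ⟨⟨hu, -⟩, hv, -⟩ := AlignedClocks.mem_interior_S10.1 (hc.mem_interior_S10 ha t)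
  have hu' := hc.strictMono_halfSum ha ht
  have hv' := hc.strictMono_halfDiff ha ht
  simp only [hc.zero, halfSum_saddle, halfDiff_saddle] at hu' hv'
  exact AlignedClocks.mem_interior_s1.2 ⟨⟨hu, hu'⟩, hv, hv'⟩

theorem mem_interior_s4 (hc : IsStableCurve a c) (ha : a ∈ Ioo (0 : ℝ) (1 / 3)) {t : ℝ}
    (ht : 0 < t) : c t ∈ interior s4 := by
  obtain ⟨⟨-, hu⟩, -, hv⟩ := AlignedClocks.mem_interior_S10.1 (hc.mem_interior_S10 ha t)
  have hu' := hc.strictMono_halfSum ha ht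
  have hv' := hc.strictMono_halfDiff ha ht
  simp only [hc.zero, halfSum_saddle, halfDiff_saddle] at hu' hv'
  exact AlignedClocks.mem_interior_s4.2 ⟨⟨hu', hu⟩, hv', hv⟩

theorem exists_tendsto_atBot (hc : IsStableCurve a c) (ha : a ∈ Ioo (0 : ℝ) (1 / 3)) :
    ∃ p, Tendsto c atBot (𝓝 p) := by
  have hmem (t : ℝ) := AlignedClocks.mem_interior_S10.1 (hc.mem_interior_S10 ha t)
  have hu := tendsto_atBot_ciInf (hc.strictMono_halfSum ha).monotone
    ⟨0, forall_mem_range.2 fun t => (hmem t).1.1.le⟩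
  have hv := tendsto_atBot_ciInf (hc.strictMono_halfDiff ha).monotone
    ⟨0, forall_mem_range.2 fun t => (hmem t).2.1.le⟩
  exact ⟨_, ((diagHomeo.symm.continuous.tendsto _).comp (hu.prodMk_nhds hv)).congr fun t =>
    diagHomeo.symm_apply_apply (c t)⟩

-- The limit is a fixed point, and the origin is the only one it can be.
theorem tendsto_atBot (hc : IsStableCurve a c) (ha : a ∈ Ioo (0 : ℝ) (1 / 3)) :
    Tendsto c atBot (𝓝 (0, 0)) := by
  obtain ⟨p, hp⟩ := hc.exists_tendsto_atBot ha
  have hfix : F a p = p := by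
    have hl : Tendsto (stableEigenvalue a * ·) atBot atBot :=
      tendsto_id.const_mul_atBot (stableEigenvalue_mem_Ioo ha).1
    exact tendsto_nhds_unique (((continuous_F a).tendsto p).comp hp)
      ((hp.comp hl).congr hc.semiconj)
  have hu : Tendsto (fun t => halfSum (c t)) atBot (𝓝 (halfSum p)) :=
    (continuous_halfSum.tendsto p).comp hp
  have hv : Tendsto (fun t => halfDiff (c t)) atBot (𝓝 (halfDiff p)) :=
    (continuous_halfDiff.tendsto p).comp hp
  have hmem (t : ℝ) := AlignedClocks.mem_interior_S10.1 (hc.mem_interior_S10 ha t)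
  obtain ⟨⟨-, hu1⟩, -, hv1⟩ :=
    AlignedClocks.mem_interior_s1.1 (hc.mem_interior_s1 ha neg_one_lt_zero)
  have hu0 := ge_of_tendsto' hu fun t => (hmem t).1.1.le
  have hv0 := ge_of_tendsto' hv fun t => (hmem t).2.1.le
  have huc := ((hc.strictMono_halfSum ha).monotone.le_of_tendsto hu (-1)).trans_lt hu1
  have hvc := ((hc.strictMono_halfDiff ha).monotone.le_of_tendsto hv (-1)).trans_lt hv1
  have hp0 : p = (0, 0) := eq_zero_of_F_eq_self ha.1.ne' hfix
    ⟨by linarith [pi_pos], huc⟩ ⟨by linarith [pi_pos], hvc⟩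
  rwa [hp0] at hp

theorem tendsto_atTop (hc : IsStableCurve a c) (ha : a ∈ Ioo (0 : ℝ) (1 / 3)) :
    Tendsto c atTop (𝓝 (2 * π, 0)) := by
  have h := (continuous_rot.tendsto _).comp ((hc.tendsto_atBot ha).comp tendsto_neg_atTop_atBot)
  have hrot : rot (0, 0) = (2 * π, 0) := by simp [rot]
  rw [hrot] at h
  exact h.congr fun t => by simp [hc.neg, rot_involutive (c t)]

theorem exists_fst_eq (hc : IsStableCurve a c) (ha : a ∈ Ioo (0 : ℝ) (1 / 3)) {x : ℝ}
    (hx : x ∈ Ioo 0 (2 * π)) : ∃ t, (c t).1 = x := by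
  have hbot := (continuous_fst.tendsto _).comp (hc.tendsto_atBot ha)
  have htop := (continuous_fst.tendsto _).comp (hc.tendsto_atTop ha)
  obtain ⟨s, hs⟩ := (hbot.eventually_lt_const hx.1).exists
  obtain ⟨t, ht⟩ := (htop.eventually_const_lt hx.2).exists
  exact mem_range_of_exists_le_of_exists_ge (continuous_fst.comp hc.continuous) ⟨s, hs.le⟩
    ⟨t, ht.le⟩

theorem range_eq_basin (hc : IsStableCurve a c) (ha : a ∈ Ioo (0 : ℝ) (1 / 3)) :
    range c = basin (F a) (π, 0) := by
  refine Subset.antisymm (range_subset_iff.2 (hc.mem_basin ha)) fun z hz => ?_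
  obtain ⟨t, ht⟩ := hc.exists_fst_eq ha
    (fst_mem_Ioo_of_mem_interior_S10 (basin_subset_interior_S10 (abs_lt_of_mem_Ioo ha) hz))
  exact ⟨t, injOn_fst_basin ha (hc.mem_basin ha t) hz ht⟩

theorem image_Iio_union_image_Ioi_union_saddle (hc : IsStableCurve a c)
    (ha : a ∈ Ioo (0 : ℝ) (1 / 3)) :
    c '' Iio 0 ∪ c '' Ioi 0 ∪ {(π, 0)} = basin (F a) (π, 0) := by
  rw [← hc.range_eq_basin ha, ← hc.zero, ← image_singleton, ← image_union, ← image_union,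
    Iio_union_Ioi, compl_union_self, image_univ]

theorem rot_image_Iio (hc : IsStableCurve a c) : rot '' (c '' Iio 0) = c '' Ioi 0 := by
  rw [image_image]
  simp only [← hc.neg]
  rw [← image_image c Neg.neg, image_neg_eq_neg, neg_Iio, neg_zero]

theorem basin_inter_s1 (hc : IsStableCurve a c) (ha : a ∈ Ioo (0 : ℝ) (1 / 3)) :
    basin (F a) (π, 0) ∩ s1 = c '' Iio 0 ∪ {(π, 0)} := by
  have hIio : c '' Iio 0 ⊆ s1 := by
    rintro _ ⟨t, ht, rfl⟩
    exact interior_subset (hc.mem_interior_s1 ha ht)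
  have hIoi : c '' Ioi 0 ∩ s1 = ∅ := by
    rw [← disjoint_iff_inter_eq_empty, disjoint_left]
    rintro _ ⟨t, ht, rfl⟩ hs
    obtain ⟨⟨hu, -⟩, -⟩ := AlignedClocks.mem_interior_s4.1 (hc.mem_interior_s4 ha ht)
    exact hu.not_ge (mem_s1.1 hs).1.2
  have hsaddle : (π, 0) ∈ s1 := by
    rw [mem_s1, halfSum_saddle, halfDiff_saddle]
    constructor <;> constructor <;> linarith [pi_pos]
  rw [← hc.image_Iio_union_image_Ioi_union_saddle ha, union_inter_distrib_right,
    union_inter_distrib_right, hIoi, union_empty, inter_eq_left.2 hIio,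
    inter_eq_left.2 (singleton_subset_iff.2 hsaddle)]

theorem basin_inter_interior_s1 (hc : IsStableCurve a c) (ha : a ∈ Ioo (0 : ℝ) (1 / 3)) :
    basin (F a) (π, 0) ∩ interior s1 = c '' Iio 0 := by
  have hIio : c '' Iio 0 ⊆ interior s1 := image_subset_iff.2 fun t ht => hc.mem_interior_s1 ha ht
  have hsaddle : {(π, 0)} ∩ interior s1 = ∅ := by
    rw [singleton_inter_eq_empty, AlignedClocks.mem_interior_s1, halfSum_saddle]
    exact fun h => h.1.2.false
  rw [← inter_eq_right.2 interior_subset, ← inter_assoc, hc.basin_inter_s1 ha,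
    union_inter_distrib_right, hsaddle, union_empty, inter_eq_left.2 hIio]

theorem isHeteroclinicCurve_Iio (hc : IsStableCurve a c) (ha : a ∈ Ioo (0 : ℝ) (1 / 3)) :
    IsHeteroclinicCurve (F a) (0, 0) (π, 0) (c '' Iio 0) := by
  obtain ⟨hl0, hl1⟩ := stableEigenvalue_mem_Ioo ha
  rw [← hc.zero]
  exact isHeteroclinicCurve_image_Iio hc.semiconj hl0 hl1 hc.smooth (hc.tendsto_atBot ha) (F_zero a)
    (by simp [hc.zero, pi_ne_zero.symm])

theorem isHeteroclinicCurve_Ioi (hc : IsStableCurve a c) (ha : a ∈ Ioo (0 : ℝ) (1 / 3)) :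
    IsHeteroclinicCurve (F a) (2 * π, 0) (π, 0) (c '' Ioi 0) := by
  obtain ⟨hl0, hl1⟩ := stableEigenvalue_mem_Ioo ha
  have hsemi : Function.Semiconj (fun t => c (-t)) (stableEigenvalue a * ·) (F a) := fun t => by
    simp only [← mul_neg]
    exact hc.semiconj (-t)
  have hsmooth : IsSmoothCurve fun t => c (-t) := by
    refine ⟨hc.smooth.1.comp contDiff_neg, hc.smooth.2.1.comp neg_injective, fun t => ?_⟩
    rw [deriv_comp_neg]
    exact neg_ne_zero.2 (hc.smooth.2.2 _)
  have himage : c '' Ioi 0 = (fun t => c (-t)) '' Iio 0 := by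
    rw [← image_image c Neg.neg, image_neg_eq_neg, neg_Iio, neg_zero]
  have hne : (2 * π, (0 : ℝ)) ≠ c (-0) := by simp [hc.zero, pi_ne_zero]
  have h := isHeteroclinicCurve_image_Iio hsemi hl0 hl1 hsmooth
    ((hc.tendsto_atTop ha).comp tendsto_neg_atBot_atTop) (F_two_pi a) hne
  rwa [← himage, neg_zero, hc.zero] at h

end IsStableCurve

/-! ### The domains above and below the stable curve -/

section VerticalOrder

variable {η A : Set (ℝ × ℝ)}

theorem disjoint_above_below (hη : InjOn Prod.fst η) (A : Set (ℝ × ℝ)) :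
    Disjoint (above η A) (below η A) := by
  rw [disjoint_left]
  rintro z ⟨-, w, hw, hwz, hlt⟩ ⟨-, w', hw', hwz', hlt'⟩
  obtain rfl : w = w' := hη hw hw' (hwz.trans hwz'.symm)
  exact hlt.not_gt hlt'

theorem above_union_below (hη : InjOn Prod.fst η) (A : Set (ℝ × ℝ)) :
    above η A ∪ below η A = (A ∩ Prod.fst ⁻¹' (Prod.fst '' η)) \ η := by
  ext z
  constructor
  · rintro (⟨hz, w, hw, hwz, hlt⟩ | ⟨hz, w, hw, hwz, hlt⟩)
    · exact ⟨⟨hz, w, hw, hwz⟩, fun hzη => hlt.ne (congrArg Prod.snd (hη hw hzη hwz))⟩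
    · exact ⟨⟨hz, w, hw, hwz⟩, fun hzη => hlt.ne' (congrArg Prod.snd (hη hw hzη hwz))⟩
  · rintro ⟨⟨hz, w, hw, hwz⟩, hzη⟩
    rcases lt_trichotomy w.2 z.2 with hlt | heq | hlt
    · exact Or.inl ⟨hz, w, hw, hwz, hlt⟩
    · exact absurd (Prod.ext hwz heq ▸ hw) hzη
    · exact Or.inr ⟨hz, w, hw, hwz, hlt⟩

theorem below_eq_preimage_rot_above (hη : MapsTo rot η η) (hA : MapsTo rot A A) :
    below η A = rot ⁻¹' above η A := by
  ext z
  constructor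
  · rintro ⟨hz, w, hw, hwz, hlt⟩
    exact ⟨hA hz, rot w, hη hw, by simp [rot, hwz], by simpa [rot] using hlt⟩
  · rintro ⟨hz, w, hw, hwz, hlt⟩
    refine ⟨rot_involutive z ▸ hA hz, rot w, hη hw, ?_, ?_⟩ <;> simp only [rot] at hwz hlt ⊢ <;>
      linarith

theorem isConnected_between {T : Type*} [TopologicalSpace T] [ConnectedSpace T] {x g h : T → ℝ}
    (hx : Continuous x) (hg : Continuous g) (hh : Continuous h) (hgh : ∀ t, g t < h t) :
    IsConnected {z : ℝ × ℝ | ∃ t, x t = z.1 ∧ z.2 ∈ Ioo (g t) (h t)} := by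
  have himage : {z : ℝ × ℝ | ∃ t, x t = z.1 ∧ z.2 ∈ Ioo (g t) (h t)} =
      (fun p : T × ℝ => (x p.1, AffineMap.lineMap (g p.1) (h p.1) p.2)) '' (univ ×ˢ Ioo 0 1) := by
    ext ⟨x', y⟩
    simp only [mem_ofPred_eq, mem_image, mem_prod, mem_univ, true_and, Prod.exists, Prod.mk.injEq,
      ← openSegment_eq_Ioo (hgh _), openSegment_eq_image_lineMap]
    grind
  rw [himage]
  refine (isConnected_univ.prod (isConnected_Ioo zero_lt_one)).image _ (Continuous.continuousOn ?_)
  simp only [AffineMap.lineMap_apply_module]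
  fun_prop

end VerticalOrder

theorem mapsTo_rot_S10 : MapsTo rot S10 S10 := fun z hz => by
  obtain ⟨⟨hu0, hu1⟩, hv0, hv1⟩ := mem_S10.1 hz
  rw [mem_S10, halfSum_rot, halfDiff_rot]
  exact ⟨⟨by linarith, by linarith⟩, by linarith, by linarith⟩

theorem mapsTo_rot_interior_S10 : MapsTo rot (interior S10) (interior S10) := fun z hz => by
  obtain ⟨⟨hu0, hu1⟩, hv0, hv1⟩ := mem_interior_S10.1 hz
  rw [mem_interior_S10, halfSum_rot, halfDiff_rot]
  exact ⟨⟨by linarith, by linarith⟩, by linarith, by linarith⟩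

theorem fst_mem_Ioo_iff_of_mem_S10 {z : ℝ × ℝ} (hz : z ∈ S10) :
    z.1 ∈ Ioo 0 (2 * π) ↔ z ∉ ({(0, 0), (2 * π, 0)} : Set (ℝ × ℝ)) := by
  obtain ⟨⟨hu0, hu1⟩, hv0, hv1⟩ := mem_S10.1 hz
  have hfst := fst_eq_halfSum_add_halfDiff z
  have hsnd := snd_eq_halfSum_sub_halfDiff z
  constructor
  · rintro h (rfl | rfl)
    exacts [h.1.false, h.2.false]
  · contrapose!
    intro h
    rw [mem_Ioo, not_and_or, not_lt, not_lt] at h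
    rcases h with h | h
    · exact Or.inl (Prod.ext (by dsimp; linarith) (by dsimp; linarith))
    · exact Or.inr (Prod.ext (by dsimp; linarith) (by dsimp; linarith))

theorem mem_interior_S10_iff_abs_lt {z : ℝ × ℝ} :
    z ∈ interior S10 ↔ |z.2| < min z.1 (2 * π - z.1) := by
  rw [mem_interior_S10, lt_min_iff, abs_lt, abs_lt, halfSum, halfDiff]
  constructor
  · rintro ⟨⟨hu0, hu1⟩, hv0, hv1⟩
    exact ⟨⟨by linarith, by linarith⟩, by linarith, by linarith⟩
  · rintro ⟨⟨h₁, h₂⟩, h₃, h₄⟩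
    exact ⟨⟨by linarith, by linarith⟩, by linarith, by linarith⟩

section Splitting

variable {a : ℝ} {A : Set (ℝ × ℝ)}

theorem image_fst_basin (ha : a ∈ Ioo (0 : ℝ) (1 / 3)) :
    Prod.fst '' basin (F a) (π, 0) = Ioo 0 (2 * π) := by
  obtain ⟨c, hc⟩ := exists_isStableCurve ha
  refine Subset.antisymm (image_subset_iff.2 fun z hz => ?_) fun x hx => ?_
  · exact fst_mem_Ioo_of_mem_interior_S10 (basin_subset_interior_S10 (abs_lt_of_mem_Ioo ha) hz)
  · obtain ⟨t, ht⟩ := hc.exists_fst_eq ha hx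
    exact ⟨c t, hc.mem_basin ha t, ht⟩

theorem closure_basin (ha : a ∈ Ioo (0 : ℝ) (1 / 3)) :
    closure (basin (F a) (π, 0)) = basin (F a) (π, 0) ∪ {(0, 0), (2 * π, 0)} := by
  obtain ⟨c, hc⟩ := exists_isStableCurve ha
  rw [← hc.range_eq_basin ha]
  exact closure_range_of_tendsto hc.continuous (hc.tendsto_atBot ha) (hc.tendsto_atTop ha)

theorem mapsTo_rot_basin (ha : a ∈ Ioo (0 : ℝ) (1 / 3)) :
    MapsTo rot (basin (F a) (π, 0)) (basin (F a) (π, 0)) := by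
  obtain ⟨c, hc⟩ := exists_isStableCurve ha
  rw [← hc.range_eq_basin ha]
  rintro _ ⟨t, rfl⟩
  exact ⟨-t, hc.neg t⟩

theorem above_basin_union_below_basin (ha : a ∈ Ioo (0 : ℝ) (1 / 3)) (hA : A ⊆ S10) :
    above (basin (F a) (π, 0)) A ∪ below (basin (F a) (π, 0)) A =
      A \ closure (basin (F a) (π, 0)) := by
  rw [above_union_below (injOn_fst_basin ha), image_fst_basin ha, closure_basin ha]
  ext z
  simp only [Set.mem_sdiff, mem_inter_iff, mem_preimage, mem_union, not_or]
  grind [fst_mem_Ioo_iff_of_mem_S10]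

theorem above_basin_union_below_basin_interior (ha : a ∈ Ioo (0 : ℝ) (1 / 3)) :
    above (basin (F a) (π, 0)) (interior S10) ∪ below (basin (F a) (π, 0)) (interior S10) =
      interior S10 \ basin (F a) (π, 0) := by
  have hsub : interior S10 ⊆ Prod.fst ⁻¹' Ioo 0 (2 * π) := fun _ => fst_mem_Ioo_of_mem_interior_S10
  rw [above_union_below (injOn_fst_basin ha), image_fst_basin ha, inter_eq_left.2 hsub]

theorem mem_above_basin_of_coneLE (ha : a ∈ Ioo (0 : ℝ) (1 / 3)) {w z : ℝ × ℝ}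
    (hw : w ∈ basin (F a) (π, 0)) (h : ConeLE w z) (hne : w ≠ z) (hzA : z ∈ A)
    (hz : z.1 ∈ Ioo 0 (2 * π)) : z ∈ above (basin (F a) (π, 0)) A := by
  obtain ⟨y, hy, hyz⟩ : z.1 ∈ Prod.fst '' basin (F a) (π, 0) := (image_fst_basin ha).ge hz
  refine ⟨hzA, y, hy, hyz, ?_⟩
  rcases eq_or_ne w y with rfl | hwy
  · exact lt_of_le_of_ne (sub_nonneg.1 ((abs_nonneg _).trans h)) fun h' => hne (Prod.ext hyz h')
  · have hlt := abs_snd_sub_lt_of_mem_basin ha hy hw hwy.symm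
    rw [hyz] at hlt
    linarith [(abs_lt.1 (hlt.trans_le h)).2]

theorem mapsTo_above_basin (ha : a ∈ Ioo (0 : ℝ) (1 / 3)) (hA : A ⊆ S10) (hFA : F a ⁻¹' A = A) :
    MapsTo (F a) (above (basin (F a) (π, 0)) A) (above (basin (F a) (π, 0)) A) := by
  have hinj := (homeoF (abs_lt_of_mem_Ioo ha)).injective
  rintro z ⟨hz, w, hw, hwz, hlt⟩
  have hFz : F a z ∈ A := hFA.ge hz
  have hFw : F a w ∈ basin (F a) (π, 0) := preimage_basin.ge hw
  have hwS : w ∈ S10 := interior_subset (basin_subset_interior_S10 (abs_lt_of_mem_Ioo ha) hw)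
  have hne : w ≠ z := fun h => hlt.ne (congrArg Prod.snd h)
  have hle : ConeLE (F a w) (F a z) :=
    (coneLE_of_fst_eq hwz hlt.le).map_F (Ioo_subset_Icc_self ha) hwS (hA hz)
  refine mem_above_basin_of_coneLE ha hFw hle (hinj.ne hne) hFz ?_
  have hzx : z.1 ∈ Ioo 0 (2 * π) := (image_fst_basin ha).le ⟨w, hw, hwz⟩
  rw [fst_mem_Ioo_iff_of_mem_S10 (hA hz), mem_insert_iff, mem_singleton_iff, not_or] at hzx
  rw [fst_mem_Ioo_iff_of_mem_S10 (hA hFz), mem_insert_iff, mem_singleton_iff, not_or]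
  exact ⟨(hinj.ne_iff' (F_zero a)).2 hzx.1, (hinj.ne_iff' (F_two_pi a)).2 hzx.2⟩

theorem mapsTo_below_basin (ha : a ∈ Ioo (0 : ℝ) (1 / 3)) (hA : A ⊆ S10) (hFA : F a ⁻¹' A = A)
    (hrot : MapsTo rot A A) :
    MapsTo (F a) (below (basin (F a) (π, 0)) A) (below (basin (F a) (π, 0)) A) := by
  rw [below_eq_preimage_rot_above (mapsTo_rot_basin ha) hrot]
  intro z hz
  rw [mem_preimage, ← F_rot]
  exact mapsTo_above_basin ha hA hFA hz

theorem image_sdiff_closure_basin (ha : |a| < 1 / 3) (hFA : F a ⁻¹' A = A) :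
    F a '' (A \ closure (basin (F a) (π, 0))) = A \ closure (basin (F a) (π, 0)) := by
  have hclosure : F a ⁻¹' closure (basin (F a) (π, 0)) = closure (basin (F a) (π, 0)) := calc
    _ = closure (F a ⁻¹' basin (F a) (π, 0)) := (homeoF ha).preimage_closure _
    _ = _ := by rw [preimage_basin]
  exact image_eq_of_preimage_eq (F_surjective ha) (by rw [preimage_sdiff, hFA, hclosure])

theorem image_above_basin (ha : a ∈ Ioo (0 : ℝ) (1 / 3)) (hA : A ⊆ S10) (hFA : F a ⁻¹' A = A)
    (hrot : MapsTo rot A A) :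
    F a '' above (basin (F a) (π, 0)) A = above (basin (F a) (π, 0)) A :=
  image_eq_of_mapsTo_of_disjoint (above_basin_union_below_basin ha hA)
    (disjoint_above_below (injOn_fst_basin ha) A)
    (image_sdiff_closure_basin (abs_lt_of_mem_Ioo ha) hFA) (mapsTo_above_basin ha hA hFA)
    (mapsTo_below_basin ha hA hFA hrot)

theorem image_below_basin (ha : a ∈ Ioo (0 : ℝ) (1 / 3)) (hA : A ⊆ S10) (hFA : F a ⁻¹' A = A)
    (hrot : MapsTo rot A A) :
    F a '' below (basin (F a) (π, 0)) A = below (basin (F a) (π, 0)) A :=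
  image_eq_of_mapsTo_of_disjoint ((union_comm _ _).trans (above_basin_union_below_basin ha hA))
    (disjoint_above_below (injOn_fst_basin ha) A).symm
    (image_sdiff_closure_basin (abs_lt_of_mem_Ioo ha) hFA) (mapsTo_below_basin ha hA hFA hrot)
    (mapsTo_above_basin ha hA hFA)

theorem isOpen_above_basin (ha : a ∈ Ioo (0 : ℝ) (1 / 3)) :
    IsOpen (above (basin (F a) (π, 0)) (interior S10)) := by
  rw [isOpen_iff_mem_nhds]
  rintro z ⟨hz, w, hw, hwz, hlt⟩
  have hopen : IsOpen {y : ℝ × ℝ | |y.1 - w.1| < y.2 - w.2} :=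
    isOpen_lt (by fun_prop) (by fun_prop)
  have hmem : z ∈ {y : ℝ × ℝ | |y.1 - w.1| < y.2 - w.2} := by simpa [hwz] using hlt
  filter_upwards [isOpen_interior.mem_nhds hz, hopen.mem_nhds hmem] with y hy hwy
  refine mem_above_basin_of_coneLE ha hw hwy.le ?_ hy (fst_mem_Ioo_of_mem_interior_S10 hy)
  rintro rfl
  simp at hwy

theorem isConnected_above_basin (ha : a ∈ Ioo (0 : ℝ) (1 / 3)) :
    IsConnected (above (basin (F a) (π, 0)) (interior S10)) := by
  obtain ⟨c, hc⟩ := exists_isStableCurve ha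
  have hmem (t : ℝ) := abs_lt.1 (mem_interior_S10_iff_abs_lt.1 (hc.mem_interior_S10 ha t))
  have hbetween : above (basin (F a) (π, 0)) (interior S10) =
      {z | ∃ t, (c t).1 = z.1 ∧ z.2 ∈ Ioo (c t).2 (min (c t).1 (2 * π - (c t).1))} := by
    ext z
    simp only [above, mem_ofPred_eq, mem_interior_S10_iff_abs_lt, ← hc.range_eq_basin ha,
      exists_range_iff]
    constructor
    · rintro ⟨hz, t, htz, hlt⟩
      exact ⟨t, htz, hlt, htz ▸ (abs_lt.1 hz).2⟩
    · rintro ⟨t, htz, hlt, hlt'⟩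
      exact ⟨abs_lt.2 ⟨htz ▸ (hmem t).1.trans hlt, htz ▸ hlt'⟩, t, htz, hlt⟩
  have hcont := hc.continuous
  rw [hbetween]
  exact isConnected_between (by fun_prop) (by fun_prop) (by fun_prop) fun t => (hmem t).2

theorem splitsInvariantly_basin (ha : a ∈ Ioo (0 : ℝ) (1 / 3)) :
    SplitsInvariantly (F a) (basin (F a) (π, 0)) S10 := by
  have hFS := F_preimage_S10 (abs_lt_of_mem_Ioo ha)
  have hFI := F_preimage_interior_S10 (abs_lt_of_mem_Ioo ha)
  have hdisj := disjoint_above_below (injOn_fst_basin ha)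
  have hbelow := below_eq_preimage_rot_above (mapsTo_rot_basin ha) mapsTo_rot_interior_S10
  exact {
    isOpen_above := isOpen_above_basin ha
    isOpen_below := hbelow ▸ (isOpen_above_basin ha).preimage continuous_rot
    isConnected_above := isConnected_above_basin ha
    isConnected_below := by
      rw [hbelow, ← rot_involutive.image_eq_preimage_symm]
      exact (isConnected_above_basin ha).image _ continuous_rot.continuousOn
    disjoint_interior := hdisj _
    union_interior := above_basin_union_below_basin_interior ha
    invariant_above := image_above_basin ha interior_subset hFI mapsTo_rot_interior_S10
    invariant_below := image_below_basin ha interior_subset hFI mapsTo_rot_interior_S10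
    disjoint_self := hdisj _
    union_self := above_basin_union_below_basin ha Subset.rfl
    invariant_above_self := image_above_basin ha Subset.rfl hFS mapsTo_rot_S10
    invariant_below_self := image_below_basin ha Subset.rfl hFS mapsTo_rot_S10 }

end Splitting

end

end AlignedClocks

open AlignedClocks in
theorem theorem1_general (a : ℝ) (ha0 : 0 < a) (ha1 : a < 1 / 3) :
    IsUnstableNode (F a) (0, 0) ∧ IsUnstableNode (F a) (2 * Real.pi, 0) ∧
    IsSaddle (F a) (Real.pi, 0) ∧ F a '' S10 = S10 ∧
    ∃ γL γR : Set (ℝ × ℝ),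
      IsHeteroclinicCurve (F a) (0, 0) (Real.pi, 0) γL ∧ γL ⊆ interior s1 ∧
      γR = rot '' γL ∧
      IsHeteroclinicCurve (F a) (2 * Real.pi, 0) (Real.pi, 0) γR ∧ γR ⊆ interior s4 ∧
      (∀ U ∈ 𝓝 ((Real.pi, 0) : ℝ × ℝ),
        stableManifold (F a) (Real.pi, 0) U ∩ interior s1 = γL ∧
        stableManifold (F a) (Real.pi, 0) U ∩ s1 = γL ∪ {(Real.pi, 0)} ∧
        stableManifold (F a) (Real.pi, 0) U = γL ∪ γR ∪ {(Real.pi, 0)}) ∧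
      (∃ c : ℝ → ℝ × ℝ, IsSmoothCurve c ∧ c 0 = (Real.pi, 0) ∧ deriv c 0 = (2 + √3, 1) ∧
        c '' Iio 0 = γL ∧ c '' Ioi 0 = γR) ∧
      closure (γL ∪ γR ∪ {(Real.pi, 0)}) =
        γL ∪ γR ∪ {(Real.pi, 0), (0, 0), (2 * Real.pi, 0)} ∧
      SplitsInvariantly (F a) (γL ∪ γR ∪ {(Real.pi, 0)}) S10 := by
  have ha : a ∈ Ioo 0 (1 / 3) := ⟨ha0, ha1⟩
  have ha' : |a| < 1 / 3 := abs_lt_of_mem_Ioo ha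
  obtain ⟨c, hc⟩ := exists_isStableCurve ha
  have hη := hc.image_Iio_union_image_Ioi_union_saddle ha
  refine ⟨isUnstableNode_of_cos_eq_one ha0 (F_zero a) (by simp) (by simp),
    isUnstableNode_of_cos_eq_one ha0 (F_two_pi a) (by simp) (by simp), isSaddle_pi ha,
    image_eq_of_preimage_eq (F_surjective ha') (F_preimage_S10 ha'), c '' Iio 0, c '' Ioi 0,
    hc.isHeteroclinicCurve_Iio ha, image_subset_iff.2 fun _ => hc.mem_interior_s1 ha,
    hc.rot_image_Iio.symm, hc.isHeteroclinicCurve_Ioi ha,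
    image_subset_iff.2 fun _ => hc.mem_interior_s4 ha, fun U hU => ?_,
    ⟨c, hc.smooth, hc.zero, hc.hasDerivAt.deriv, rfl, rfl⟩, ?_, ?_⟩
  · rw [stableManifold_eq_basin hU]
    exact ⟨hc.basin_inter_interior_s1 ha, hc.basin_inter_s1 ha, hη.symm⟩
  · rw [← singleton_union, ← union_assoc, hη, closure_basin ha]
  · rw [hη]
    exact splitsInvariantly_basin ha

open AlignedClocks in
theorem theorem1 (a : ℝ) (ha0 : 0 < a) (ha1 : a < 1 / 6) :
    IsUnstableNode (F a) (0, 0) ∧ IsUnstableNode (F a) (2 * Real.pi, 0) ∧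
    IsSaddle (F a) (Real.pi, 0) ∧ F a '' S10 = S10 ∧
    ∃ γL γR : Set (ℝ × ℝ),
      -- the heteroclinic curve on the left, in the small square `s1`
      IsHeteroclinicCurve (F a) (0, 0) (Real.pi, 0) γL ∧ γL ⊆ interior s1 ∧
      -- its image under the internal symmetry, in the small square `s4`
      γR = rot '' γL ∧
      IsHeteroclinicCurve (F a) (2 * Real.pi, 0) (Real.pi, 0) γR ∧ γR ⊆ interior s4 ∧
      -- they are the branches of the global stable manifold of the saddle
      (∀ U ∈ 𝓝 ((Real.pi, 0) : ℝ × ℝ),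
        stableManifold (F a) (Real.pi, 0) U ∩ interior s1 = γL ∧
        stableManifold (F a) (Real.pi, 0) U ∩ s1 = γL ∪ {(Real.pi, 0)} ∧
        stableManifold (F a) (Real.pi, 0) U = γL ∪ γR ∪ {(Real.pi, 0)}) ∧
      -- which is a smooth curve tangent to the stable direction at the saddle
      (∃ c : ℝ → ℝ × ℝ, IsSmoothCurve c ∧ c 0 = (Real.pi, 0) ∧ deriv c 0 = (2 + √3, 1) ∧
        c '' Iio 0 = γL ∧ c '' Ioi 0 = γR) ∧
      -- and together they split the square
      closure (γL ∪ γR ∪ {(Real.pi, 0)}) =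
        γL ∪ γR ∪ {(Real.pi, 0), (0, 0), (2 * Real.pi, 0)} ∧
      SplitsInvariantly (F a) (γL ∪ γR ∪ {(Real.pi, 0)}) S10 :=
  theorem1_general a ha0 (by linarith)
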